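/- Let $K$ and $G$ be compact Lie groups, let $M$ be a smooth manifold (Hausdorff, second countable, of constant dimension, without boundary) with a smooth left $G$-action, let $x\in M$ and let $\sigma:K\to G_x$ be a homomorphism of Lie groups into the isotropy group at $x$. Let $H=C_G(\sigma(K))$ be the centralizer of $\sigma(K)$ in $G$. *Notation.* $G\ltimes M$ is the action groupoid: an arrow $(g,y)$ goes from $y$ to $gy$, and $(g',gy)(g,y)=(g'g,y)$. A homomorphism $\varphi$ from $K$ to a topological groupoid $\mathcal G$ consists of an object $\omega(\varphi)$ and a continuous homomorphism from $K$ to the isotropy group of $\mathcal G$ at $\omega(\varphi)$; the set $\hom(K,\mathcal G)$ of these is a subspace of $C(K,\mathcal G_1)$ with the compact-open topology ($\mathcal G_1$ is the space of arrows), and $\mathcal G$ acts on it along $\omega$ by conjugation, $(g\varphi)(k)=g\varphi(k)g^{-1}$. For $\mathcal G=G\ltimes M$ this is a $G$-action. For $\rho\in\hom(K,\mathcal G)$, $\hom(K,\mathcal G;\rho)$ is the minimal union of path-components of $\hom(K,\mathcal G)$ that contains $\rho$ and is saturated for the $\mathcal G$-action, and $\Sigma(\mathcal G;\rho)=\omega(\hom(K,\mathcal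 G;\rho))$. Let $\mathrm{fix}_{\sigma(K)}(M)$ be the space of points fixed by $\sigma(K)$ and $\mathrm{fix}_{\sigma(K)}(M;x)$ its path-component containing $x$. For $y\in \mathrm{fix}_{\sigma(K)}(M)$ let $\bar\sigma(y)\in\hom(K,G\ltimes M)$ be $\bar\sigma(y)(k)=(\sigma(k),y)$. $\mathrm{sat}_\Gamma(A)$ is the union of the $\Gamma$-orbits that meet $A$. For an $H$-saturated $S\subset M$, $G\times_H S$ is the quotient of $G\times S$ by the right $H$-action $(g,y)h=(gh,h^{-1}y)$, with $G$ acting by $g'\cdot(g,y)H=(g'g,y)H$. **(i)** The set $\hom(K,G\ltimes M;\bar\sigma(x))$ is open, closed and $G$-saturated in $\hom(K,G\ltimes M)$, and $$G\times_H\,\mathrm{sat}_H\big(\mathrm{fix}_{\sigma(K)}(M;x)\big)\to\hom(K,G\ltimes M;\bar\sigma(x)),\qquad (g,y)H\mapsto\big(k\mapsto(g\sigma(k)g^{-1},gy)\big),$$ is a (well-defined) $G$-equivariant homeomorphism. In particular $\hom(K,G\ltimes M;\bar\sigma(x))$ has a natural structure of a smooth manifold: $\mathrm{sat}_H(\mathrm{fix}_{\sigma(K)}(M;x))$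 is an embedded submanifold of $M$ (of constant dimension), and $\hom(K,G\ltimes M;\bar\sigma(x))$ is Hausdorff, second countable, and has a smooth structure of constant dimension, compatible with its topology, for which the map $G\times\mathrm{sat}_H(\mathrm{fix}_{\sigma(K)}(M;x))\to\hom(K,G\ltimes M;\bar\sigma(x))$ induced by the homeomorphism above is a smooth submersion. **(ii)** $\hom(K,G\ltimes M;\bar\sigma(x))=\mathrm{sat}_G\big(\bar\sigma(\mathrm{fix}_{\sigma(K)}(M;x))\big)$ and $\Sigma(G\ltimes M;\bar\sigma(x))=\mathrm{sat}_G\big(\mathrm{fix}_{\sigma(K)}(M;x)\big)$. -/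

import Mathlib

open scoped Manifold ContDiff

/-- A topological groupoid with space of objects `Ob` and space of arrows `Arr`. The product
`mul g' g` is defined when the source of `g'` is the target of `g`. -/
structure TopGroupoid (Ob Arr : Type*) [TopologicalSpace Ob] [TopologicalSpace Arr] where
  src : Arr → Ob
  tgt : Arr → Ob
  mul : ∀ g' g : Arr, src g' = tgt g → Arr
  unit : Ob → Arr
  inv : Arr → Arr
  src_mul : ∀ g' g h, src (mul g' g h) = src g
  tgt_mul : ∀ g' g h, tgt (mul g' g h) = tgt g'
  src_unit : ∀ x, src (unit x) = x
  tgt_unit : ∀ x, tgt (unit x) = x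
  src_inv : ∀ g, src (inv g) = tgt g
  tgt_inv : ∀ g, tgt (inv g) = src g
  mul_assoc : ∀ a b c (h : src a = tgt b) (h' : src b = tgt c),
    mul (mul a b h) c ((src_mul a b h).trans h') = mul a (mul b c h') (h.trans (tgt_mul b c h').symm)
  mul_unit : ∀ g, mul g (unit (src g)) (tgt_unit _).symm = g
  unit_mul : ∀ g, mul (unit (tgt g)) g (src_unit _) = g
  mul_inv : ∀ g, mul g (inv g) (tgt_inv g).symm = unit (tgt g)
  inv_mul : ∀ g, mul (inv g) g (src_inv g) = unit (src g)
  continuous_src : Continuous src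
  continuous_tgt : Continuous tgt
  continuous_mul : Continuous fun p : {p : Arr × Arr // src p.1 = tgt p.2} => mul p.1.1 p.1.2 p.2
  continuous_unit : Continuous unit
  continuous_inv : Continuous inv

namespace TopGroupoid

variable {Ob Arr : Type*} [TopologicalSpace Ob] [TopologicalSpace Arr]

/-- A homomorphism of topological groupoids from a topological group `K` (a groupoid with one
object) to `𝒢`: an object `ω φ = φ.obj` and a continuous homomorphism from `K` to the isotropy
group of `𝒢` at that object. -/
structure Hom (K : Type*) [Group K] [TopologicalSpace K] (𝒢 : TopGroupoid Ob Arr) where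
  obj : Ob
  map : C(K, Arr)
  src_map : ∀ k, 𝒢.src (map k) = obj
  tgt_map : ∀ k, 𝒢.tgt (map k) = obj
  map_one : map 1 = 𝒢.unit obj
  map_mul : ∀ k k', map (k * k') = 𝒢.mul (map k) (map k') ((src_map k).trans (tgt_map k').symm)

variable {K : Type*} [Group K] [TopologicalSpace K] {𝒢 : TopGroupoid Ob Arr}

/-- The topology of a subspace of `C(K, Arr)` with the compact-open topology. -/
instance : TopologicalSpace (Hom K 𝒢) := TopologicalSpace.induced Hom.map inferInstance

theorem Hom.ext_map {φ ψ : Hom K 𝒢} (h : ∀ k, φ.map k = ψ.map k) : φ = ψ := by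
  obtain ⟨x, f, hs, ht, h1, hm⟩ := φ
  obtain ⟨y, f', hs', ht', h1', hm'⟩ := ψ
  have hf : f = f' := ContinuousMap.ext h
  subst hf
  have hx : x = y := (hs 1).symm.trans (hs' 1)
  subst hx
  rfl

/-- The arrow `g a g⁻¹`, for `a` in the isotropy group at the source of `g`. -/
def conjArr (𝒢 : TopGroupoid Ob Arr) (g a : Arr) (hs : 𝒢.src a = 𝒢.src g)
    (ht : 𝒢.tgt a = 𝒢.src g) : Arr :=
  𝒢.mul (𝒢.mul g a ht.symm) (𝒢.inv g) ((𝒢.src_mul _ _ _).trans (hs.trans (𝒢.tgt_inv g).symm))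

theorem mul_congr (𝒢 : TopGroupoid Ob Arr) {a a' b b' : Arr} (ha : a = a') (hb : b = b')
    (h : 𝒢.src a = 𝒢.tgt b) : 𝒢.mul a b h = 𝒢.mul a' b' (by rw [← ha, ← hb]; exact h) := by
  subst ha; subst hb; rfl

theorem conjArr_unit (𝒢 : TopGroupoid Ob Arr) (g : Arr) :
    𝒢.conjArr g (𝒢.unit (𝒢.src g)) (𝒢.src_unit _) (𝒢.tgt_unit _) = 𝒢.unit (𝒢.tgt g) := by
  unfold conjArr
  rw [𝒢.mul_congr (𝒢.mul_unit g) rfl, 𝒢.mul_inv]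

theorem conjArr_mul (𝒢 : TopGroupoid Ob Arr) (g a b : Arr) (has : 𝒢.src a = 𝒢.src g)
    (hat : 𝒢.tgt a = 𝒢.src g) (hbs : 𝒢.src b = 𝒢.src g) (hbt : 𝒢.tgt b = 𝒢.src g) :
    𝒢.conjArr g (𝒢.mul a b (has.trans hbt.symm)) ((𝒢.src_mul _ _ _).trans hbs)
      ((𝒢.tgt_mul _ _ _).trans hat) =
    𝒢.mul (𝒢.conjArr g a has hat) (𝒢.conjArr g b hbs hbt) (by
      simp [conjArr, 𝒢.src_mul, 𝒢.tgt_mul, 𝒢.src_inv]) := by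
  have e1 : 𝒢.src (𝒢.inv g) = 𝒢.tgt g := 𝒢.src_inv g
  have e2 : 𝒢.tgt (𝒢.inv g) = 𝒢.src g := 𝒢.tgt_inv g
  unfold conjArr
  -- right-hand side: `(g a) g⁻¹ ((g b) g⁻¹)`
  rw [𝒢.mul_assoc (𝒢.mul g a hat.symm) (𝒢.inv g)]
  · have step : 𝒢.mul (𝒢.inv g) (𝒢.mul (𝒢.mul g b hbt.symm) (𝒢.inv g)
        ((𝒢.src_mul _ _ _).trans (hbs.trans e2.symm)))
        (by simp [𝒢.tgt_mul, e1]) = 𝒢.mul b (𝒢.inv g) (hbs.trans e2.symm) := by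
      rw [← 𝒢.mul_assoc (𝒢.inv g) (𝒢.mul g b hbt.symm) (𝒢.inv g) (by simp [𝒢.tgt_mul, e1])
        ((𝒢.src_mul _ _ _).trans (hbs.trans e2.symm))]
      refine 𝒢.mul_congr ?_ rfl _
      rw [← 𝒢.mul_assoc (𝒢.inv g) g b e1 hbt.symm]
      rw [𝒢.mul_congr (𝒢.inv_mul g) rfl, 𝒢.mul_congr (congrArg 𝒢.unit hbt.symm) rfl, 𝒢.unit_mul]
    rw [𝒢.mul_congr rfl step]
    rw [← 𝒢.mul_assoc (𝒢.mul g a hat.symm) b (𝒢.inv g)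
      ((𝒢.src_mul _ _ _).trans (has.trans hbt.symm)) (hbs.trans e2.symm)]
    exact 𝒢.mul_congr (𝒢.mul_assoc g a b hat.symm (has.trans hbt.symm)).symm rfl _
  · simp [𝒢.tgt_mul, e1]

/-- The conjugate `gφ`, `(gφ)(k) = g φ(k) g⁻¹`, for an arrow `g` with source `ω φ`: the left action
of `𝒢` on `Hom K 𝒢` along `ω`. -/
def Hom.conj (φ : Hom K 𝒢) (g : Arr) (hg : 𝒢.src g = φ.obj) : Hom K 𝒢 where
  obj := 𝒢.tgt g
  map :=
    { toFun := fun k => 𝒢.conjArr g (φ.map k) ((φ.src_map k).trans hg.symm)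
        ((φ.tgt_map k).trans hg.symm)
      continuous_toFun := by
        unfold conjArr
        have h1 : Continuous fun k => 𝒢.mul g (φ.map k) (hg.trans (φ.tgt_map k).symm) :=
          𝒢.continuous_mul.comp (Continuous.subtype_mk
            (continuous_const.prodMk φ.map.continuous) fun k => hg.trans (φ.tgt_map k).symm)
        exact 𝒢.continuous_mul.comp (Continuous.subtype_mk (h1.prodMk continuous_const) fun k =>
          (𝒢.src_mul _ _ _).trans (((φ.src_map k).trans hg.symm).trans (𝒢.tgt_inv g).symm)) }
  src_map := fun k => by simp [conjArr, 𝒢.src_mul, 𝒢.src_inv]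
  tgt_map := fun k => by simp [conjArr, 𝒢.tgt_mul]
  map_one := by
    have h : φ.map 1 = 𝒢.unit (𝒢.src g) := by rw [hg, φ.map_one]
    simp only [ContinuousMap.coe_mk, h]
    exact 𝒢.conjArr_unit g
  map_mul := fun k k' => by
    simp only [ContinuousMap.coe_mk, φ.map_mul]
    exact 𝒢.conjArr_mul g _ _ _ _ _ _

/-- The space `hom(K, 𝒢; ρ)`: the minimal union of path-components of `Hom K 𝒢` which includes `ρ`
and is saturated for the conjugation action of `𝒢`. -/
def homComponent (ρ : Hom K 𝒢) : Set (Hom K 𝒢) :=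
  ⋂₀ {S | ρ ∈ S ∧ (∀ φ ∈ S, pathComponent φ ⊆ S) ∧
    ∀ φ ∈ S, ∀ (g : Arr) (hg : 𝒢.src g = φ.obj), φ.conj g hg ∈ S}

/-- `Σ(𝒢; ρ) = ω(hom(K, 𝒢; ρ))`. -/
def sigmaSet (ρ : Hom K 𝒢) : Set Ob := Hom.obj '' homComponent ρ

end TopGroupoid

/-- The saturation of `A`: the union of the `Γ`-orbits that intersect `A`. -/
def saturation (Γ : Type*) {X : Type*} [Group Γ] [MulAction Γ X] (A : Set X) : Set X :=
  ⋃ a ∈ A, MulAction.orbit Γ a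

/-- `fix_L(M; x)`: the path-component of the space of fixed points of `L` which includes `x`. -/
def fixComponent {G M : Type*} [Group G] [TopologicalSpace M] [MulAction G M] (L : Subgroup G)
    (x : M) : Set M :=
  pathComponentIn (MulAction.fixedPoints L M) x

section Image

variable {G M K : Type*} [Group G] [TopologicalSpace G] [MulAction G M] [Group K]
  [TopologicalSpace K]

/-- The image `σ(K) ⊆ G` of a homomorphism `σ : K → G_x`. -/
def imageSubgroup {x : M} (σ : K →ₜ* MulAction.stabilizer G x) : Subgroup G :=
  σ.toMonoidHom.range.map (MulAction.stabilizer G x).subtype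

theorem mem_fixedPoints_imageSubgroup {x : M} (σ : K →ₜ* MulAction.stabilizer G x) :
    x ∈ MulAction.fixedPoints (imageSubgroup σ) M := by
  rintro ⟨_, g, -, rfl⟩
  exact g.2

end Image

section Action

variable (G M : Type*) [Group G] [TopologicalSpace G] [IsTopologicalGroup G]
  [TopologicalSpace M] [MulAction G M] [ContinuousSMul G M]

/-- The action groupoid `G ⋉ M`: the arrow `(g, y)` goes from `y` to `g • y`, and
`(g', g • y) (g, y) = (g' g, y)`. -/
def actionGroupoid : TopGroupoid M (G × M) where
  src := fun a => a.2
  tgt := fun a => a.1 • a.2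
  mul := fun a b _ => (a.1 * b.1, b.2)
  unit := fun y => (1, y)
  inv := fun a => (a.1⁻¹, a.1 • a.2)
  src_mul := fun _ _ _ => rfl
  tgt_mul := fun a b h => by rw [h, mul_smul]
  src_unit := fun _ => rfl
  tgt_unit := fun y => one_smul G y
  src_inv := fun _ => rfl
  tgt_inv := fun a => inv_smul_smul a.1 a.2
  mul_assoc := fun a b c _ _ => by simp only [mul_assoc]
  mul_unit := fun a => by simp
  unit_mul := fun a => by simp
  mul_inv := fun a => by simp
  inv_mul := fun a => by simp
  continuous_src := continuous_snd
  continuous_tgt := continuous_smul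
  continuous_mul := by fun_prop
  continuous_unit := by fun_prop
  continuous_inv := by fun_prop

variable {G M} {K : Type*} [Group K] [TopologicalSpace K]

/-- The action of `G ⋉ M` on `Hom K (G ⋉ M)`, seen as an action of `G`: `g` acts on `φ` as
conjugation by the only arrow of `G ⋉ M` with first component `g` and source `ω φ`. -/
instance : MulAction G (TopGroupoid.Hom K (actionGroupoid G M)) where
  smul := fun g φ => φ.conj (g, φ.obj) rfl
  one_smul := fun φ => TopGroupoid.Hom.ext_map fun k => by
    have h := φ.src_map k
    change ((1 : G) * (φ.map k).1 * (1 : G)⁻¹, (1 : G) • φ.obj) = φ.map k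
    rw [one_smul, ← h]
    simp [actionGroupoid]
  mul_smul := fun g g' φ => TopGroupoid.Hom.ext_map fun k => by
    change ((g * g') * (φ.map k).1 * (g * g')⁻¹, (g * g') • φ.obj) =
      (g * (g' * (φ.map k).1 * g'⁻¹) * g⁻¹, g • (g' • φ.obj))
    rw [mul_smul]
    simp [mul_assoc]

/-- The homomorphism `σ̄(y) : K → G ⋉ M`, `k ↦ (σ(k), y)`, at a fixed point `y` of `σ(K)`. -/
def sigmaBar {x : M} (σ : K →ₜ* MulAction.stabilizer G x) (y : M)
    (hy : y ∈ MulAction.fixedPoints (imageSubgroup σ) M) :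
    TopGroupoid.Hom K (actionGroupoid G M) where
  obj := y
  map := ⟨fun k => ((σ k : G), y), by fun_prop⟩
  src_map := fun _ => rfl
  tgt_map := fun k => hy ⟨σ k, ⟨σ k, ⟨k, rfl⟩, rfl⟩⟩
  map_one := by simp [actionGroupoid]
  map_mul := fun k k' => by simp [actionGroupoid]

/-- `H = C_G(σ(K))`. -/
abbrev imageCentralizer {x : M} (σ : K →ₜ* MulAction.stabilizer G x) : Subgroup G :=
  Subgroup.centralizer (imageSubgroup σ : Set G)

/-- `sat_H(fix_{σ(K)}(M; x))`, where `H = C_G(σ(K))`. -/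
abbrev satFix {x : M} (σ : K →ₜ* MulAction.stabilizer G x) : Set M :=
  saturation (imageCentralizer σ) (fixComponent (imageSubgroup σ) x)

/-- `σ̄(x)`. -/
abbrev sigmaBarBase {x : M} (σ : K →ₜ* MulAction.stabilizer G x) :
    TopGroupoid.Hom K (actionGroupoid G M) :=
  sigmaBar σ x (mem_fixedPoints_imageSubgroup σ)

/-- `hom(K, G ⋉ M; σ̄(x))`. -/
abbrev homSigmaBar {x : M} (σ : K →ₜ* MulAction.stabilizer G x) :
    Set (TopGroupoid.Hom K (actionGroupoid G M)) :=
  TopGroupoid.homComponent (sigmaBarBase σ)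

end Action

section BalancedProduct

variable {G M : Type*} [Group G] [MulAction G M]

/-- `(g, y)` and `(g', y')` are equivalent when `(g', y') = (g h, h⁻¹ • y)` for some `h ∈ H`. -/
def balancedSetoid (H : Subgroup G) (S : Set M) : Setoid (G × S) where
  r := fun p q => ∃ h ∈ H, q.1 = p.1 * h ∧ (q.2 : M) = h⁻¹ • (p.2 : M)
  iseqv :=
    { refl := fun p => ⟨1, H.one_mem, by simp, by simp⟩
      symm := by
        rintro p q ⟨h, hh, h1, h2⟩
        exact ⟨h⁻¹, H.inv_mem hh, by simp [h1], by simp [h2]⟩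
      trans := by
        rintro p q r ⟨h, hh, h1, h2⟩ ⟨h', hh', h1', h2'⟩
        exact ⟨h * h', H.mul_mem hh hh', by rw [h1', h1, mul_assoc],
          by rw [h2', h2, mul_inv_rev, mul_smul]⟩ }

/-- `G ×_H S = (G × S) / H`, for an `H`-saturated subset `S` of `M`. -/
def BalancedProduct (H : Subgroup G) (S : Set M) : Type _ := Quotient (balancedSetoid H S)

/-- The class `(g, y)H`. -/
def BalancedProduct.mk (H : Subgroup G) (S : Set M) (p : G × S) : BalancedProduct H S :=
  Quotient.mk (balancedSetoid H S) p

/-- The quotient topology. -/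
instance [TopologicalSpace G] [TopologicalSpace M] (H : Subgroup G) (S : Set M) :
    TopologicalSpace (BalancedProduct H S) :=
  TopologicalSpace.coinduced (BalancedProduct.mk H S) inferInstance

/-- `g' • (g, y)H = (g' g, y)H`. -/
instance (H : Subgroup G) (S : Set M) : MulAction G (BalancedProduct H S) where
  smul := fun g => Quotient.map (fun p => (g * p.1, p.2)) (by
    rintro p q ⟨h, hh, h1, h2⟩
    exact ⟨h, hh, by simp [h1, mul_assoc], h2⟩)
  one_smul := by
    rintro ⟨p⟩
    exact congrArg (BalancedProduct.mk H S) (by simp)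
  mul_smul := by
    rintro g g' ⟨p⟩
    exact congrArg (BalancedProduct.mk H S) (by simp [mul_assoc])

end BalancedProduct

/-- A smooth submersion between finite-dimensional manifolds without boundary. -/
def IsSmoothSubmersion {E F A B X Y : Type*} [NormedAddCommGroup E] [NormedSpace ℝ E]
    [NormedAddCommGroup F] [NormedSpace ℝ F] [TopologicalSpace A] [TopologicalSpace B]
    (I : ModelWithCorners ℝ E A) (J : ModelWithCorners ℝ F B) [TopologicalSpace X]
    [ChartedSpace A X] [TopologicalSpace Y] [ChartedSpace B Y] (f : X → Y) : Prop :=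
  ContMDiff I J ∞ f ∧ ∀ p : X, Function.Surjective (mfderiv I J f p)

/-! Write F for the set of points of M fixed by σ(K), S for the H-saturation of the path-component
of x in F, and consider the orbit map (g, y) ↦ g • σ̄(y) from G × S to the space of homomorphisms.
Everything topological follows once its image is known to be open and closed. The image is
G-saturated and contains σ̄(x), and a clopen set is a union of path-components, so it contains the
component of σ̄(x). Conversely, σ̄ turns paths in F into paths of homomorphisms, so the component
contains the image. The fibres of the orbit map are the H-orbits on G × S (`sigmaOrbitMap_eq_iff`),
and the map is closed because G is compact (`isClosedMap_sigmaOrbitMap`); hence the homeomorphism.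

For the clopen property, averaging a chart against Haar measure linearises the action of K near a
point of F (`nonempty_equivariantChart`, Bochner). So F is locally a linear subspace, hence locally
path-connected, and both S and F \ S are closed in M. By rigidity (`exists_nhds_forall_conj`) a
homomorphism K → G uniformly close to σ is conjugate to it. Thus the homomorphisms with G-component
conjugate to σ form an open set, the disjoint union of the closed images of G × S and G × (F \ S).
Rigidity is a centre of mass argument: k ↦ ρ(k)σ(k)⁻¹ takes values near 1, has a unique centre of
mass g near 1, and uniqueness forces ρ(k) g σ(k)⁻¹ = g.

For the smooth structure, the linearised charts are slice charts of S in M. Their dimension is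
constant because the dimension of the space of fixed vectors is locally constant along paths in F
and is invariant under H. The same linearisation for conjugation of K on G gives a slice chart at 1
for H, the fixed point set of that action. A transversal to H then provides local sections of G × S
→ G ×_H S (`exists_local_factorization`, `exists_local_quotient_at_one`), and these make the
quotient a manifold and the quotient map a submersion. -/

open scoped Topology
open MeasureTheory Set

/-! ### Smoothness of integrals over a compact space with a smooth parameter -/

section ParametricIntegral

universe u

variable {EN HN N : Type*} [NormedAddCommGroup EN] [NormedSpace ℝ EN] [TopologicalSpace HN]
  (I : ModelWithCorners ℝ EN HN) [TopologicalSpace N] [ChartedSpace HN N] [IsManifold I ∞ N]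
  {E : Type u} [NormedAddCommGroup E] [NormedSpace ℝ E]

/-- The partial derivative of a jointly smooth map is jointly smooth. -/
theorem contMDiffOn_partial_fderiv {F : Type*} [NormedAddCommGroup F] [NormedSpace ℝ F]
    {ψ : N × E → F} {O : Set (N × E)} (hO : IsOpen O)
    (hψ : ContMDiffOn (I.prod 𝓘(ℝ, E)) 𝓘(ℝ, F) ∞ ψ O) :
    ContMDiffOn (I.prod 𝓘(ℝ, E)) 𝓘(ℝ, E →L[ℝ] F) ∞
      (fun p : N × E => fderiv ℝ (fun u => ψ (p.1, u)) p.2) O := by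
  intro p hp
  refine ContMDiffAt.contMDiffWithinAt ?_
  have h1 : ContMDiffAt (I.prod 𝓘(ℝ, E)) 𝓘(ℝ, F) ∞ ψ p := hψ.contMDiffAt (hO.mem_nhds hp)
  have h2 : ContMDiffAt ((I.prod 𝓘(ℝ, E)).prod 𝓘(ℝ, E)) (I.prod 𝓘(ℝ, E)) ∞
      (fun q : (N × E) × E => (q.1.1, q.2)) (p, p.2) :=
    (contMDiffAt_fst.fst).prodMk contMDiffAt_snd
  have h3 : ContMDiffAt ((I.prod 𝓘(ℝ, E)).prod 𝓘(ℝ, E)) 𝓘(ℝ, F) ∞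
      (Function.uncurry fun (x : N × E) (u : E) => ψ (x.1, u)) (p, p.2) :=
    ContMDiffAt.comp (p, p.2) (g := ψ) h1 h2
  have h4 := ContMDiffAt.mfderiv (m := ∞) (n := ∞) (fun (x : N × E) (u : E) => ψ (x.1, u)) Prod.snd h3
    contMDiffAt_snd (by simp)
  have h5 := inTangentCoordinates_model_space (I := 𝓘(ℝ, E)) (I' := 𝓘(ℝ, F)) (Prod.snd : N × E → E)
    (fun x => ψ (x.1, x.2)) (fun x => mfderiv 𝓘(ℝ, E) 𝓘(ℝ, F) (fun u => ψ (x.1, u)) x.2) p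
  rw [h5] at h4
  simpa only [mfderiv_eq_fderiv] using h4

omit [IsManifold I ∞ N] in
theorem differentiableAt_partial {F : Type*} [NormedAddCommGroup F] [NormedSpace ℝ F]
    {ψ : N × E → F} {O : Set (N × E)} (hO : IsOpen O)
    (hψ : ContMDiffOn (I.prod 𝓘(ℝ, E)) 𝓘(ℝ, F) ∞ ψ O) {p : N × E} (hp : p ∈ O) :
    DifferentiableAt ℝ (fun u => ψ (p.1, u)) p.2 := by
  have h1 : ContMDiffAt (I.prod 𝓘(ℝ, E)) 𝓘(ℝ, F) ∞ ψ p := hψ.contMDiffAt (hO.mem_nhds hp)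
  have h2 : ContMDiffAt 𝓘(ℝ, E) (I.prod 𝓘(ℝ, E)) ∞ (fun u : E => (p.1, u)) p.2 :=
    contMDiffAt_const.prodMk contMDiffAt_id
  have h3 : ContMDiffAt 𝓘(ℝ, E) 𝓘(ℝ, F) ∞ (fun u => ψ (p.1, u)) p.2 :=
    ContMDiffAt.comp p.2 (g := ψ) h1 h2
  exact (contMDiffAt_iff_contDiffAt.1 h3).differentiableAt (by simp)

variable {K : Type*} [TopologicalSpace K] [CompactSpace K] [T2Space K] [MeasurableSpace K] [BorelSpace K]
  (μ : Measure K) [IsFiniteMeasure μ]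

theorem Continuous.integrable_of_compactSpace {F : Type*} [NormedAddCommGroup F]
    {f : K → F} (hf : Continuous f) : Integrable f μ := by
  rw [← integrableOn_univ]
  exact hf.continuousOn.integrableOn_compact isCompact_univ

variable [FiniteDimensional ℝ E] {γ : K → N} (hγ : Continuous γ)

include hγ in
theorem hasFDerivAt_integral_of_contMDiffOn {F F' : Type*} [NormedAddCommGroup F]
    [NormedSpace ℝ F] [NormedAddCommGroup F'] [NormedSpace ℝ F']
    {L : K → F →L[ℝ] F'} (hL : Continuous L)
    {ψ : N × E → F} {O : Set (N × E)} (hO : IsOpen O)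
    (hψ : ContMDiffOn (I.prod 𝓘(ℝ, E)) 𝓘(ℝ, F) ∞ ψ O) {V : Set E} (hV : IsOpen V)
    (hVO : ∀ k, ∀ u ∈ V, (γ k, u) ∈ O) {u : E} (hu : u ∈ V) :
    HasFDerivAt (fun u => ∫ k, L k (ψ (γ k, u)) ∂μ)
      (∫ k, (L k).comp (fderiv ℝ (fun u => ψ (γ k, u)) u) ∂μ) u := by
  have := FiniteDimensional.proper_real E
  have hc : ∀ u ∈ V, Continuous fun k => L k (ψ (γ k, u)) := fun u hu => by
    refine hL.clm_apply ?_
    exact hψ.continuousOn.comp_continuous (by fun_prop) fun k => hVO k u hu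
  have hd := (contMDiffOn_partial_fderiv I hO hψ).continuousOn
  have hd' : ContinuousOn (fun q : K × E =>
      (L q.1).comp (fderiv ℝ (fun u => ψ (γ q.1, u)) q.2)) (univ ×ˢ V) := by
    refine ContinuousOn.clm_comp (by fun_prop) ?_
    exact hd.comp (f := fun q : K × E => (γ q.1, q.2)) (by fun_prop)
      fun q hq => hVO q.1 q.2 hq.2
  obtain ⟨ε, hε, hball⟩ := Metric.nhds_basis_closedBall.mem_iff.1 (hV.mem_nhds hu)
  -- Compactness of K times a closed ball gives a constant dominating function.
  obtain ⟨C, hC⟩ := (isCompact_univ.prod (isCompact_closedBall u ε)).exists_bound_of_continuousOn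
    (hd'.mono (prod_mono_right hball))
  refine hasFDerivAt_integral_of_dominated_of_fderiv_le
    (F' := fun u k => (L k).comp (fderiv ℝ (fun u => ψ (γ k, u)) u)) (bound := fun _ => C)
    (Metric.closedBall_mem_nhds u hε) ?_ ((hc u hu).integrable_of_compactSpace μ) ?_ ?_
    (integrable_const C) ?_
  · filter_upwards [hV.mem_nhds hu] with v hv
    exact ((hc v hv).integrable_of_compactSpace μ).aestronglyMeasurable
  · have : Continuous fun k => (L k).comp (fderiv ℝ (fun u => ψ (γ k, u)) u) :=
      hd'.comp_continuous (f := fun k => (k, u)) (by fun_prop) fun k => ⟨mem_univ _, hu⟩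
    exact (this.integrable_of_compactSpace μ).aestronglyMeasurable
  · exact Filter.Eventually.of_forall fun k v hv => hC (k, v) ⟨mem_univ _, hv⟩
  · refine Filter.Eventually.of_forall fun k v hv => ?_
    exact (L k).hasFDerivAt.comp v
      (differentiableAt_partial I hO hψ (hVO k v (hball hv))).hasFDerivAt

include hγ in
-- Differentiating under the integral gives an integral of the same shape, with `L k` replaced by
-- composition with `L k` and ψ by its partial derivative. The factor `L` and the arbitrary targets
-- F, F' are there to close the induction; the targets share the universe of E because they are
-- replaced by E →L F and E →L F'.
theorem contDiffOn_integral_of_contMDiffOn_nat (n : ℕ) {V : Set E} (hV : IsOpen V)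
    {O : Set (N × E)} (hO : IsOpen O) (hVO : ∀ k, ∀ u ∈ V, (γ k, u) ∈ O) :
    ∀ {F F' : Type u} [NormedAddCommGroup F] [NormedSpace ℝ F] [NormedAddCommGroup F']
    [NormedSpace ℝ F'] {L : K → F →L[ℝ] F'} (_ : Continuous L) {ψ : N × E → F}
    (_ : ContMDiffOn (I.prod 𝓘(ℝ, E)) 𝓘(ℝ, F) ∞ ψ O),
    ContDiffOn ℝ n (fun u => ∫ k, L k (ψ (γ k, u)) ∂μ) V := by
  induction n with
  | zero =>
    intro F F' _ _ _ _ L hL ψ hψ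
    refine contDiffOn_zero.2 fun u hu => ?_
    exact (hasFDerivAt_integral_of_contMDiffOn I μ hγ hL hO hψ hV hVO
      hu).continuousAt.continuousWithinAt
  | succ n ih =>
    intro F F' _ _ _ _ L hL ψ hψ
    have key := fun u hu => hasFDerivAt_integral_of_contMDiffOn I μ hγ hL hO hψ hV hVO (u := u) hu
    have hL' : Continuous fun k => ContinuousLinearMap.compL ℝ E F F' (L k) := by fun_prop
    push_cast
    rw [contDiffOn_succ_iff_fderiv_of_isOpen hV]
    refine ⟨fun u hu => (key u hu).differentiableAt.differentiableWithinAt, by simp, ?_⟩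
    refine (ih hL' (contMDiffOn_partial_fderiv I hO hψ)).congr fun u hu => ?_
    rw [(key u hu).fderiv]
    simp

include hγ in
theorem contDiffOn_integral_of_contMDiffOn {F F' : Type u} [NormedAddCommGroup F]
    [NormedSpace ℝ F] [NormedAddCommGroup F'] [NormedSpace ℝ F']
    {L : K → F →L[ℝ] F'} (hL : Continuous L)
    {ψ : N × E → F} {O : Set (N × E)} (hO : IsOpen O)
    (hψ : ContMDiffOn (I.prod 𝓘(ℝ, E)) 𝓘(ℝ, F) ∞ ψ O) {V : Set E} (hV : IsOpen V)
    (hVO : ∀ k, ∀ u ∈ V, (γ k, u) ∈ O) :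
    ContDiffOn ℝ ∞ (fun u => ∫ k, L k (ψ (γ k, u)) ∂μ) V :=
  contDiffOn_infty.2 fun n => contDiffOn_integral_of_contMDiffOn_nat I μ hγ n hV hO hVO hL hψ

end ParametricIntegral

/-! ### Linearisation of a compact group action at a fixed point -/

theorem exists_openPartialHomeomorph_of_hasFDerivAt_id {E : Type*} [NormedAddCommGroup E]
    [NormedSpace ℝ E] [CompleteSpace E] {J : E → E} {V : Set E} (hV : IsOpen V)
    (hJ : ContDiffOn ℝ ∞ J V) {c : E} (hc : c ∈ V)
    (hd : HasFDerivAt J (ContinuousLinearMap.id ℝ E) c) :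
    ∃ j : OpenPartialHomeomorph E E, c ∈ j.source ∧ j.source ⊆ V ∧ (∀ u, j u = J u) ∧
      ContDiffOn ℝ ∞ j.symm j.target := by
  have hcd : ContDiffAt ℝ ∞ J c := hJ.contDiffAt (hV.mem_nhds hc)
  have hd' : HasFDerivAt J ((ContinuousLinearEquiv.refl ℝ E : E ≃L[ℝ] E) : E →L[ℝ] E) c := hd
  have h0 : (∞ : WithTop ℕ∞) ≠ 0 := by simp
  let j₀ := hcd.toOpenPartialHomeomorph J hd' h0
  -- Restricting to points with invertible derivative makes the inverse smooth on the whole target,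
  -- not only at the image of c.
  have hD : IsOpen (V ∩ fderiv ℝ J ⁻¹' (range fun e : E ≃L[ℝ] E => (e : E →L[ℝ] E))) :=
    (hJ.continuousOn_fderiv_of_isOpen hV (by simp)).isOpen_inter_preimage hV
      ContinuousLinearEquiv.isOpen
  refine ⟨j₀.restrOpen _ hD, ⟨hcd.mem_toOpenPartialHomeomorph_source hd' h0, hc, ?_⟩,
    fun u hu => hu.2.1, fun u => rfl, fun v hv => ?_⟩
  · exact ⟨ContinuousLinearEquiv.refl ℝ E, hd.fderiv.symm⟩
  · have hu := (j₀.restrOpen _ hD).map_target hv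
    obtain ⟨e, he⟩ := hu.2.2
    have hJu : ContDiffAt ℝ ∞ J ((j₀.restrOpen _ hD).symm v) := hJ.contDiffAt (hV.mem_nhds hu.2.1)
    refine ContDiffAt.contDiffWithinAt ?_
    refine (j₀.restrOpen _ hD).contDiffAt_symm (f₀' := e) hv ?_ hJu
    have := (hJu.differentiableAt (by simp)).hasFDerivAt
    rw [← he] at this
    exact this

/-- Tube lemma: the complement is the projection of a closed set along the compact factor K. -/
theorem isOpen_forall_mem_of_compactSpace {K X Y : Type*} [TopologicalSpace K] [CompactSpace K]
    [TopologicalSpace X] [TopologicalSpace Y] {f : K × X → Y} (hf : Continuous f) {S : Set Y}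
    (hS : IsOpen S) : IsOpen {x | ∀ k, f (k, x) ∈ S} := by
  have h := isClosedMap_snd_of_compactSpace (X := K) (Y := X) _ (hS.preimage hf).isClosed_compl
  convert h.isOpen_compl using 1
  ext x
  simp

theorem exists_leftInvariant_probabilityMeasure (K : Type*) [TopologicalSpace K] [Group K]
    [IsTopologicalGroup K] [CompactSpace K] [MeasurableSpace K] [BorelSpace K] :
    ∃ μ : Measure K, IsProbabilityMeasure μ ∧ μ.IsMulLeftInvariant := by
  refine ⟨Measure.haarMeasure ⊤, ⟨?_⟩, inferInstance⟩
  have := Measure.haarMeasure_self (G := K) (K₀ := ⊤)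
  simpa using this

/-- A smooth chart around a point fixed by the action `act` of `K`, which identifies the action
near this point with a linear one. The map `proj` is a projection onto the fixed vectors. -/
structure EquivariantChart {K M : Type*} (d : ℕ) [TopologicalSpace K]
    [TopologicalSpace M] [ChartedSpace (EuclideanSpace ℝ (Fin d)) M] (act : K → M → M) (y : M) where
  chart : OpenPartialHomeomorph M (EuclideanSpace ℝ (Fin d))
  rep : K → EuclideanSpace ℝ (Fin d) →L[ℝ] EuclideanSpace ℝ (Fin d)
  proj : EuclideanSpace ℝ (Fin d) →L[ℝ] EuclideanSpace ℝ (Fin d)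
  mem_source : y ∈ chart.source
  map_eq_zero : chart y = 0
  contMDiffOn : ContMDiffOn (𝓡 d) (𝓡 d) ∞ chart chart.source
  contMDiffOn_symm : ContMDiffOn (𝓡 d) (𝓡 d) ∞ chart.symm chart.target
  act_mem : ∀ k, ∀ z ∈ chart.source, act k z ∈ chart.source
  map_act : ∀ k, ∀ z ∈ chart.source, chart (act k z) = rep k (chart z)
  continuous_rep : Continuous rep
  rep_proj : ∀ k u, rep k (proj u) = proj u
  proj_eq : ∀ u, (∀ k, rep k u = u) → proj u = u

/-- Bochner's averaging: with A the isotropy representation in a chart φ, put Φ(z) = ∫ A_k(φ(k⁻¹z) -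
φ(y)) dk. Left invariance of the measure gives Φ(kz) = A_k Φ(z), and since A_k A_{k⁻¹} = 1 the
derivative of Φ at y, read in φ, is the identity. Smoothness is asked of the map a on N × M and only
continuity of γ : K → N, so a continuous homomorphism into a Lie group suffices. -/
theorem nonempty_equivariantChart {K M N EN HN : Type*} {d : ℕ} [TopologicalSpace K] [Group K]
    [IsTopologicalGroup K] [CompactSpace K] [T2Space K]
    [TopologicalSpace M] [ChartedSpace (EuclideanSpace ℝ (Fin d)) M] [IsManifold (𝓡 d) ∞ M]
    [NormedAddCommGroup EN] [NormedSpace ℝ EN] [TopologicalSpace HN]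
    (I : ModelWithCorners ℝ EN HN) [TopologicalSpace N] [ChartedSpace HN N] [IsManifold I ∞ N]
    {a : N × M → M} (ha : ContMDiff (I.prod (𝓡 d)) (𝓡 d) ∞ a) {γ : K → N} (hγ : Continuous γ)
    {act : K → M → M} (hact : ∀ k z, act k z = a (γ k, z)) (act_one : ∀ z, act 1 z = z)
    (act_mul : ∀ k k' z, act (k * k') z = act k (act k' z)) {y : M} (hy : ∀ k, act k y = y) :
    Nonempty (EquivariantChart d act y) := by
  let E := EuclideanSpace ℝ (Fin d)
  borelize K
  obtain ⟨μ, hμ, hμ'⟩ := exists_leftInvariant_probabilityMeasure K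
  have hactc : Continuous fun p : K × M => act p.1 p.2 := by
    simp only [hact]
    exact ha.continuous.comp (by fun_prop)
  let φ : OpenPartialHomeomorph M E := chartAt E y
  have hyφ : y ∈ φ.source := mem_chart_source E y
  have hφ : ContMDiffOn (𝓡 d) (𝓡 d) ∞ φ φ.source := contMDiffOn_chart
  have hφ' : ContMDiffOn (𝓡 d) (𝓡 d) ∞ φ.symm φ.target := contMDiffOn_chart_symm
  let c : E := φ y
  have hc : c ∈ φ.target := φ.map_source hyφ
  have hφc : φ.symm c = y := φ.left_inv hyφ
  -- the action in coordinates
  let ψ : N × E → E := fun p => φ (a (p.1, φ.symm p.2)) - c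
  let m : N × E → M := fun p => a (p.1, φ.symm p.2)
  have hm : ContMDiffOn (I.prod (𝓡 d)) (𝓡 d) ∞ m (univ ×ˢ φ.target) := by
    refine ha.comp_contMDiffOn (contMDiffOn_fst.prodMk ?_)
    exact hφ'.comp contMDiffOn_snd fun p hp => hp.2
  let O : Set (N × E) := (univ ×ˢ φ.target) ∩ m ⁻¹' φ.source
  have hO : IsOpen O :=
    hm.continuousOn.isOpen_inter_preimage (isOpen_univ.prod φ.open_target) φ.open_source
  have hψ : ContMDiffOn (I.prod (𝓡 d)) (𝓡 d) ∞ ψ O := by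
    have h1 : ContMDiffOn (I.prod (𝓡 d)) (𝓡 d) ∞ (fun p => φ (m p)) O :=
      hφ.comp (hm.mono inter_subset_left) fun p hp => hp.2
    exact h1.sub contMDiffOn_const
  let A : K → E →L[ℝ] E := fun k => fderiv ℝ (fun u => ψ (γ k, u)) c
  have hcO : ∀ k, (γ k, c) ∈ O := fun k => by
    refine ⟨⟨mem_univ _, hc⟩, ?_⟩
    change a (γ k, φ.symm c) ∈ φ.source
    rw [hφc, ← hact, hy]
    exact hyφ
  have hA : Continuous A :=
    (contMDiffOn_partial_fderiv I hO hψ).continuousOn.comp_continuous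
      (f := fun k => (γ k, c)) (by fun_prop) hcO
  have hAd : ∀ k, HasFDerivAt (fun u => ψ (γ k, u)) (A k) c := fun k =>
    (differentiableAt_partial I hO hψ (hcO k)).hasFDerivAt
  -- The largest invariant subset of the chart domain; the integrand of the average makes sense on
  -- it.
  let U : Set M := {z | ∀ k, act k z ∈ φ.source}
  have hU : IsOpen U := isOpen_forall_mem_of_compactSpace hactc φ.open_source
  have hUφ : U ⊆ φ.source := fun z hz => by simpa [act_one] using hz 1
  have hyU : y ∈ U := fun k => by rw [hy]; exact hyφ
  have hactU : ∀ k, ∀ z ∈ U, act k z ∈ U := fun k z hz k' => by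
    rw [← act_mul]; exact hz _
  let V : Set E := φ.target ∩ φ.symm ⁻¹' U
  have hV : IsOpen V := φ.isOpen_inter_preimage_symm hU
  have hcV : c ∈ V := ⟨hc, by change φ.symm c ∈ U; rwa [hφc]⟩
  have hVO : ∀ k, ∀ u ∈ V, (γ k, u) ∈ O := fun k u hu => by
    refine ⟨⟨mem_univ _, hu.1⟩, ?_⟩
    change a (γ k, φ.symm u) ∈ φ.source
    rw [← hact]; exact hu.2 k
  have hψc : ∀ k, ψ (γ k, c) = 0 := fun k => by
    change φ (a (γ k, φ.symm c)) - c = 0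
    rw [hφc, ← hact, hy, sub_self]
  have A_one : A 1 = ContinuousLinearMap.id ℝ E := by
    refine (hAd 1).unique ?_
    refine ((hasFDerivAt_id c).sub_const c).congr_of_eventuallyEq ?_
    filter_upwards [φ.open_target.mem_nhds hc] with u hu
    change φ (a (γ 1, φ.symm u)) - c = u - c
    rw [← hact, act_one, φ.right_inv hu]
  have A_mul : ∀ k k', A (k * k') = (A k).comp (A k') := fun k k' => by
    refine (hAd (k * k')).unique ?_
    have h1 : HasFDerivAt (fun u => ψ (γ k', u) + c) (A k') c := (hAd k').add_const c
    have h2 : HasFDerivAt (fun u => ψ (γ k, u)) (A k) (ψ (γ k', c) + c) := by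
      rw [hψc, zero_add]; exact hAd k
    refine (HasFDerivAt.comp (f := fun u => ψ (γ k', u) + c) c h2 h1).congr_of_eventuallyEq ?_
    filter_upwards [hV.mem_nhds hcV] with u hu
    change φ (a (γ (k * k'), φ.symm u)) - c =
      φ (a (γ k, φ.symm (φ (a (γ k', φ.symm u)) - c + c))) - c
    rw [sub_add_cancel, ← hact, ← hact, ← hact, φ.left_inv (hu.2 k'), act_mul]
  have hγ' : Continuous fun k : K => γ k⁻¹ := by fun_prop
  let J : E → E := fun u => ∫ k, A k (ψ (γ k⁻¹, u)) ∂μ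
  have hJ : ContDiffOn ℝ ∞ J V :=
    contDiffOn_integral_of_contMDiffOn I μ hγ' hA hO hψ hV fun k u hu => hVO k⁻¹ u hu
  have hJc : J c = 0 := by simp [J, hψc]
  have hJd : HasFDerivAt J (ContinuousLinearMap.id ℝ E) c := by
    have h := hasFDerivAt_integral_of_contMDiffOn I μ hγ' hA hO hψ hV
      (fun k u hu => hVO k⁻¹ u hu) hcV
    have h2 : ∀ k, (A k).comp (fderiv ℝ (fun u => ψ (γ k⁻¹, u)) c) =
        ContinuousLinearMap.id ℝ E := fun k => by
      change (A k).comp (A k⁻¹) = _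
      rw [← A_mul, mul_inv_cancel, A_one]
    simpa [h2] using h
  obtain ⟨j, hcj, hjV, hjJ, hj⟩ := exists_openPartialHomeomorph_of_hasFDerivAt_id hV hJ hcV hJd
  let Φ₁ : OpenPartialHomeomorph M E := φ.trans j
  have hΦ₁U : Φ₁.source ⊆ U := fun z hz => by
    have h1 : z ∈ φ.source ∧ φ z ∈ j.source := by simpa [Φ₁] using hz
    have h2 := (hjV h1.2).2
    change φ.symm (φ z) ∈ U at h2
    rwa [φ.left_inv h1.1] at h2
  -- The domain given by the inverse function theorem need not be invariant, so the largest
  -- invariant subset is taken again.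
  let U₂ : Set M := {z | ∀ k, act k z ∈ Φ₁.source}
  have hU₂ : IsOpen U₂ := isOpen_forall_mem_of_compactSpace hactc Φ₁.open_source
  let Φ : OpenPartialHomeomorph M E := Φ₁.restrOpen U₂ hU₂
  have hΦs : Φ.source = U₂ := by
    refine (Φ₁.restrOpen_source U₂ hU₂).trans (inter_eq_right.2 fun z hz => ?_)
    simpa [act_one] using hz 1
  have hyΦ₁ : y ∈ Φ₁.source := by
    simpa [Φ₁] using And.intro hyφ hcj
  have hΦf : ∀ z ∈ U, Φ z = ∫ k, A k (φ (act k⁻¹ z) - c) ∂μ := fun z hz => by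
    change j (φ z) = _
    rw [hjJ]
    change ∫ k, A k (φ (a (γ k⁻¹, φ.symm (φ z))) - c) ∂μ = _
    simp only [φ.left_inv (hUφ hz), hact]
  have hPu : ∀ u, (∫ k, A k ∂μ) u = ∫ k, A k u ∂μ := fun u =>
    ContinuousLinearMap.integral_apply (hA.integrable_of_compactSpace μ) u
  -- The mean of the representation operators is the projection onto the fixed vectors.
  refine ⟨⟨Φ, A, ∫ k, A k ∂μ, ?_, ?_, ?_, ?_, ?_, ?_, hA, ?_, ?_⟩⟩
  · rw [hΦs]; intro k; rw [hy]; exact hyΦ₁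
  · change j (φ y) = 0
    rw [hjJ]; exact hJc
  · have h1 : ContMDiffOn (𝓡 d) (𝓡 d) ∞ j j.source := by
      rw [contMDiffOn_iff_contDiffOn]
      exact (hJ.mono hjV).congr fun u _ => hjJ u
    have h2 : Φ.source ⊆ Φ₁.source := fun z hz => hz.1
    have h3 : Φ₁.source = φ.source ∩ φ ⁻¹' j.source := OpenPartialHomeomorph.trans_source _ _
    rw [h3] at h2
    exact h1.comp (hφ.mono fun z hz => (h2 hz).1) fun z hz => (h2 hz).2
  · have h2 : Φ.target ⊆ Φ₁.target := fun z hz => hz.1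
    have h3 : Φ₁.target = j.target ∩ j.symm ⁻¹' φ.target := OpenPartialHomeomorph.trans_target _ _
    rw [h3] at h2
    exact hφ'.comp ((contMDiffOn_iff_contDiffOn.2 hj).mono fun v hv => (h2 hv).1)
      fun v hv => (h2 hv).2
  · rw [hΦs]
    intro k z hz k'
    rw [← act_mul]; exact hz _
  · intro k z hz
    rw [hΦs] at hz
    have hzU : z ∈ U := hΦ₁U (by simpa [act_one] using hz 1)
    -- The substitution k ↦ k k' in the integral for `act k z` brings out the factor `A k`.
    rw [hΦf z hzU, hΦf _ (hactU k z hzU), ← ContinuousLinearMap.integral_comp_comm,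
      ← integral_mul_left_eq_self _ k]
    · congr 1
      ext1 k'
      rw [A_mul, ← act_mul, mul_inv_rev, inv_mul_cancel_right]
      rfl
    · refine Continuous.integrable_of_compactSpace μ (hA.clm_apply (Continuous.sub ?_ continuous_const))
      refine φ.continuousOn.comp_continuous (f := fun k => act k⁻¹ z) ?_ fun k => hzU k⁻¹
      exact hactc.comp (f := fun k : K => (k⁻¹, z)) (by fun_prop)
  · intro k u
    rw [hPu, ← ContinuousLinearMap.integral_comp_comm _
      ((hA.clm_apply continuous_const).integrable_of_compactSpace μ)]
    conv_rhs => rw [← integral_mul_left_eq_self _ k]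
    simp [A_mul]
  · intro u hu
    rw [hPu]
    simp [hu]

namespace EquivariantChart

variable {K M : Type*} {d : ℕ} [TopologicalSpace K]
  [TopologicalSpace M] [ChartedSpace (EuclideanSpace ℝ (Fin d)) M] {act : K → M → M} {y : M}
  (C : EquivariantChart d act y)

theorem zero_mem_target : (0 : EuclideanSpace ℝ (Fin d)) ∈ C.chart.target :=
  C.map_eq_zero ▸ C.chart.map_source C.mem_source

theorem symm_zero : C.chart.symm 0 = y := by
  rw [← C.map_eq_zero, C.chart.left_inv C.mem_source]

theorem proj_proj (u : EuclideanSpace ℝ (Fin d)) : C.proj (C.proj u) = C.proj u :=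
  C.proj_eq _ fun k => C.rep_proj k u

/-- This is the point of linearising: in the chart the fixed point set is the linear subspace onto
which `proj` projects. -/
theorem forall_act_eq_iff {z : M} (hz : z ∈ C.chart.source) :
    (∀ k, act k z = z) ↔ C.proj (C.chart z) = C.chart z := by
  constructor
  · intro h
    exact C.proj_eq _ fun k => by rw [← C.map_act k z hz, h k]
  · intro h k
    refine C.chart.injOn (C.act_mem k z hz) hz ?_
    rw [C.map_act k z hz, ← h, C.rep_proj]

theorem act_symm_of_proj_eq {u : EuclideanSpace ℝ (Fin d)} (hu : u ∈ C.chart.target)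
    (h : C.proj u = u) (k : K) : act k (C.chart.symm u) = C.chart.symm u :=
  (C.forall_act_eq_iff (C.chart.map_target hu)).2 (by rw [C.chart.right_inv hu, h]) k

theorem contMDiffAt {z : M} (hz : z ∈ C.chart.source) :
    ContMDiffAt (𝓡 d) (𝓡 d) ∞ C.chart z :=
  C.contMDiffOn.contMDiffAt (C.chart.open_source.mem_nhds hz)

theorem contMDiffAt_symm {u : EuclideanSpace ℝ (Fin d)} (hu : u ∈ C.chart.target) :
    ContMDiffAt (𝓡 d) (𝓡 d) ∞ C.chart.symm u :=
  C.contMDiffOn_symm.contMDiffAt (C.chart.open_target.mem_nhds hu)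

end EquivariantChart

/-! ### Rigidity of homomorphisms from a compact group to a Lie group -/

section Conjugation

variable {K G : Type*} [TopologicalSpace K] [Group K]
  [IsTopologicalGroup K] [CompactSpace K] [T2Space K] [TopologicalSpace G] [Group G]

section

variable {d : ℕ} [ChartedSpace (EuclideanSpace ℝ (Fin d)) G]
  [LieGroup (𝓡 d) ∞ G]

/-- Conjugation through σ fixes 1, and its fixed points are the centralizer of σ(K). The chart
serves both as a slice chart for the centralizer and as the chart in which centres of mass are
computed equivariantly. -/
theorem nonempty_equivariantChart_conj {σ : K →* G} (hσ : Continuous σ) :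
    Nonempty (EquivariantChart d (fun (k : K) (g : G) => σ k * g * (σ k)⁻¹) 1) := by
  have : IsManifold (𝓡 d) ∞ G := inferInstance
  refine nonempty_equivariantChart (𝓡 d) (N := G) (γ := σ) (a := fun p => p.1 * p.2 * p.1⁻¹)
    ?_ hσ (fun k z => rfl) (fun z => by simp) (fun k k' z => by simp [mul_assoc]) (by simp)
  exact (contMDiff_fst.mul contMDiff_snd).mul contMDiff_fst.inv

variable {act : K → G → G} (C : EquivariantChart d act 1)

omit [Group K] [IsTopologicalGroup K] [CompactSpace K] [T2Space K] [LieGroup (𝓡 d) ∞ G] in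
theorem EquivariantChart.contDiffAt_comp₂ {b : G × G → G}
    (hb : ContMDiff ((𝓡 d).prod (𝓡 d)) (𝓡 d) ∞ b)
    {p : EuclideanSpace ℝ (Fin d) × EuclideanSpace ℝ (Fin d)}
    (h1 : p.1 ∈ C.chart.target) (h2 : p.2 ∈ C.chart.target)
    (h : b (C.chart.symm p.1, C.chart.symm p.2) ∈ C.chart.source) :
    ContDiffAt ℝ ∞ (fun p => C.chart (b (C.chart.symm p.1, C.chart.symm p.2))) p := by
  have hfst : ContMDiffAt ((𝓡 d).prod (𝓡 d)) (𝓡 d) ∞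
      (fun p : EuclideanSpace ℝ (Fin d) × EuclideanSpace ℝ (Fin d) => C.chart.symm p.1) p :=
    ContMDiffAt.comp p (C.contMDiffAt_symm h1) contMDiffAt_fst
  have hsnd : ContMDiffAt ((𝓡 d).prod (𝓡 d)) (𝓡 d) ∞
      (fun p : EuclideanSpace ℝ (Fin d) × EuclideanSpace ℝ (Fin d) => C.chart.symm p.2) p :=
    ContMDiffAt.comp p (C.contMDiffAt_symm h2) contMDiffAt_snd
  have hf : ContMDiffAt ((𝓡 d).prod (𝓡 d)) (𝓡 d) ∞
      (fun p => C.chart (b (C.chart.symm p.1, C.chart.symm p.2))) p :=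
    ContMDiffAt.comp p (C.contMDiffAt h) (ContMDiffAt.comp p (g := b) hb.contMDiffAt
      (hfst.prodMk hsnd))
  rw [← contMDiffAt_iff_contDiffAt, modelWithCornersSelf_prod, ← chartedSpaceSelf_prod]
  exact hf

omit [Group K] [IsTopologicalGroup K] [CompactSpace K] [T2Space K] in
-- The derivative is determined by its restrictions to the two axes, where the product map is the
-- identity.
theorem EquivariantChart.hasStrictFDerivAt_mul :
    HasStrictFDerivAt (fun p : EuclideanSpace ℝ (Fin d) × EuclideanSpace ℝ (Fin d) =>
      C.chart (C.chart.symm p.1 * C.chart.symm p.2))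
      (ContinuousLinearMap.fst ℝ _ _ + ContinuousLinearMap.snd ℝ _ _) (0, 0) := by
  let E := EuclideanSpace ℝ (Fin d)
  let f : E × E → E := fun p => C.chart (C.chart.symm p.1 * C.chart.symm p.2)
  have hf : ContDiffAt ℝ ∞ f (0, 0) :=
    C.contDiffAt_comp₂ (b := fun p => p.1 * p.2) (contMDiff_fst.mul contMDiff_snd)
      C.zero_mem_target C.zero_mem_target (by simpa [C.symm_zero] using C.mem_source)
  obtain ⟨f', hf'⟩ : ∃ f', HasFDerivAt f f' (0, 0) :=
    ⟨_, (hf.differentiableAt (by simp)).hasFDerivAt⟩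
  have h1 : f'.comp (ContinuousLinearMap.inr ℝ E E) = ContinuousLinearMap.id ℝ E := by
    have h : HasFDerivAt (fun v => f (0, v)) (f'.comp (ContinuousLinearMap.inr ℝ E E)) 0 :=
      HasFDerivAt.comp (0 : E) (g := f) (f := fun v => (0, v)) hf' (hasFDerivAt_prodMk_right 0 0)
    refine h.unique ((hasFDerivAt_id 0).congr_of_eventuallyEq ?_)
    filter_upwards [C.chart.open_target.mem_nhds C.zero_mem_target] with v hv
    simp [f, C.symm_zero, C.chart.right_inv hv]
  have h2 : f'.comp (ContinuousLinearMap.inl ℝ E E) = ContinuousLinearMap.id ℝ E := by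
    have h : HasFDerivAt (fun v => f (v, 0)) (f'.comp (ContinuousLinearMap.inl ℝ E E)) 0 :=
      HasFDerivAt.comp (0 : E) (g := f) (f := fun v => (v, 0)) hf' (hasFDerivAt_prodMk_left 0 0)
    refine h.unique ((hasFDerivAt_id 0).congr_of_eventuallyEq ?_)
    filter_upwards [C.chart.open_target.mem_nhds C.zero_mem_target] with v hv
    simp [f, C.symm_zero, C.chart.right_inv hv]
  have h3 : f' = ContinuousLinearMap.fst ℝ E E + ContinuousLinearMap.snd ℝ E E := by
    ext1
    · rw [h2]; ext1 u; simp
    · rw [h1]; ext1 u; simp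
  exact h3 ▸ hf.hasStrictFDerivAt' hf' (by simp)

omit [Group K] [IsTopologicalGroup K] [CompactSpace K] [T2Space K] in
-- The map vanishes on the diagonal and is the identity on the second axis, which determines the
-- derivative. Strictness yields the Lipschitz estimate behind the centre of mass.
theorem EquivariantChart.hasStrictFDerivAt_inv_mul :
    HasStrictFDerivAt (fun p : EuclideanSpace ℝ (Fin d) × EuclideanSpace ℝ (Fin d) =>
      C.chart ((C.chart.symm p.1)⁻¹ * C.chart.symm p.2))
      (ContinuousLinearMap.snd ℝ _ _ - ContinuousLinearMap.fst ℝ _ _) (0, 0) := by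
  let E := EuclideanSpace ℝ (Fin d)
  let f : E × E → E := fun p => C.chart ((C.chart.symm p.1)⁻¹ * C.chart.symm p.2)
  have hf : ContDiffAt ℝ ∞ f (0, 0) :=
    C.contDiffAt_comp₂ (b := fun p => p.1⁻¹ * p.2) (contMDiff_fst.inv.mul contMDiff_snd)
      C.zero_mem_target C.zero_mem_target (by simpa [C.symm_zero] using C.mem_source)
  obtain ⟨f', hf'⟩ : ∃ f', HasFDerivAt f f' (0, 0) :=
    ⟨_, (hf.differentiableAt (by simp)).hasFDerivAt⟩
  have h1 : ∀ v, f' (0, v) = v := fun v => by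
    have h : HasFDerivAt (fun v => f (0, v)) (f'.comp (ContinuousLinearMap.inr ℝ E E)) 0 :=
      HasFDerivAt.comp (0 : E) (g := f) (f := fun v => (0, v)) hf' (hasFDerivAt_prodMk_right 0 0)
    have h' : HasFDerivAt (fun v => f (0, v)) (ContinuousLinearMap.id ℝ E) 0 := by
      refine (hasFDerivAt_id 0).congr_of_eventuallyEq ?_
      filter_upwards [C.chart.open_target.mem_nhds C.zero_mem_target] with v hv
      simp [f, C.symm_zero, C.chart.right_inv hv]
    simpa using DFunLike.congr_fun (h.unique h') v
  have h2 : ∀ u, f' (u, u) = 0 := fun u => by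
    have h : HasFDerivAt (fun v => f (v, v)) (f'.comp ((ContinuousLinearMap.id ℝ E).prod
        (ContinuousLinearMap.id ℝ E))) 0 :=
      HasFDerivAt.comp (0 : E) (g := f) (f := fun v => (v, v)) hf'
        ((hasFDerivAt_id 0).prodMk (hasFDerivAt_id 0))
    have h' : HasFDerivAt (fun v => f (v, v)) (0 : E →L[ℝ] E) 0 := by
      refine (hasFDerivAt_const (0 : E) 0).congr_of_eventuallyEq ?_
      filter_upwards with v
      simp [f, C.map_eq_zero]
    simpa using DFunLike.congr_fun (h.unique h') u
  have h3 : f' = ContinuousLinearMap.snd ℝ E E - ContinuousLinearMap.fst ℝ E E := by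
    refine ContinuousLinearMap.ext fun p => ?_
    have e : p = (p.1, p.1) + (0, p.2 - p.1) := by ext <;> simp
    rw [e, map_add, h1, h2]
    simp
  exact h3 ▸ hf.hasStrictFDerivAt' hf' (by simp)

end

/-- Rigidity of homomorphisms from compact groups to Lie groups: a homomorphism which is uniformly
close to `σ` is conjugate to `σ`. -/
theorem exists_nhds_forall_conj (d : ℕ) [ChartedSpace (EuclideanSpace ℝ (Fin d)) G]
    [LieGroup (𝓡 d) ∞ G] {σ : K →* G} (hσ : Continuous σ) :
    ∃ V : Set G, IsOpen V ∧ (1 : G) ∈ V ∧ ∀ ρ : K →* G, Continuous ρ →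
      (∀ k, ρ k * (σ k)⁻¹ ∈ V) → ∃ g, ∀ k, ρ k = g * σ k * g⁻¹ := by
  have : IsTopologicalGroup G := topologicalGroup_of_lieGroup (𝓡 d) ∞
  obtain ⟨C⟩ := nonempty_equivariantChart_conj (d := d) hσ
  borelize K
  obtain ⟨μ, hμ, hμ'⟩ := exists_leftInvariant_probabilityMeasure K
  -- the nearly linear difference map
  obtain ⟨s, hs, happ⟩ := C.hasStrictFDerivAt_inv_mul.approximates_deriv_on_nhds
    (c := 1 / 2) (Or.inr (by simp))
  obtain ⟨δ₁, hδ₁, hδs⟩ := Metric.mem_nhds_iff.1 hs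
  have hball : ∀ r > 0, IsOpen (C.chart.source ∩ C.chart ⁻¹' Metric.ball 0 r) ∧
      (1 : G) ∈ C.chart.source ∩ C.chart ⁻¹' Metric.ball 0 r := fun r hr =>
    ⟨C.chart.isOpen_inter_preimage Metric.isOpen_ball, C.mem_source, by
      simpa [C.map_eq_zero] using hr⟩
  -- a neighbourhood `S` of `1` such that `g⁻¹ * x` is in the domain of the chart for `g, x ∈ S`
  obtain ⟨δ, hδ, hδδ₁, hdiv⟩ : ∃ δ > 0, δ ≤ δ₁ ∧ Metric.ball (0 : EuclideanSpace ℝ (Fin d)) δ ⊆ C.chart.target ∧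
      ∀ u ∈ Metric.ball (0 : EuclideanSpace ℝ (Fin d)) δ, ∀ v ∈ Metric.ball (0 : EuclideanSpace ℝ (Fin d)) δ,
        (C.chart.symm u)⁻¹ * C.chart.symm v ∈ C.chart.source := by
    have hcont : ContinuousAt (fun p : EuclideanSpace ℝ (Fin d) × EuclideanSpace ℝ (Fin d) => (C.chart.symm p.1)⁻¹ * C.chart.symm p.2)
        (0, 0) := by
      have h0 : ContinuousAt C.chart.symm 0 := C.chart.symm.continuousAt C.zero_mem_target
      exact ((ContinuousAt.comp (f := Prod.fst) (x := ((0 : EuclideanSpace ℝ (Fin d)), (0 : EuclideanSpace ℝ (Fin d)))) h0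
        continuousAt_fst).inv).mul
        (ContinuousAt.comp (f := Prod.snd) (x := ((0 : EuclideanSpace ℝ (Fin d)), (0 : EuclideanSpace ℝ (Fin d)))) h0 continuousAt_snd)
    have h2 : ∀ᶠ p : EuclideanSpace ℝ (Fin d) × EuclideanSpace ℝ (Fin d) in 𝓝 (0, 0), (C.chart.symm p.1)⁻¹ * C.chart.symm p.2 ∈
        C.chart.source := hcont.eventually_mem (C.chart.open_source.mem_nhds (by
          simpa [C.symm_zero] using C.mem_source))
    obtain ⟨a, ha, h3⟩ := Metric.eventually_nhds_iff_ball.1 h2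
    obtain ⟨b, hb, h4⟩ := Metric.mem_nhds_iff.1 (C.chart.open_target.mem_nhds C.zero_mem_target)
    refine ⟨min δ₁ (min a b), by positivity, min_le_left _ _, fun u hu => h4 ?_, fun u hu v hv =>
      h3 (u, v) ?_⟩
    · exact Metric.ball_subset_ball ((min_le_right _ _).trans (min_le_right _ _)) hu
    · rw [← ball_prod_same]
      exact ⟨Metric.ball_subset_ball ((min_le_right _ _).trans (min_le_left _ _)) hu,
        Metric.ball_subset_ball ((min_le_right _ _).trans (min_le_left _ _)) hv⟩
  obtain ⟨htarget, hdiv⟩ := hdiv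
  let S : Set G := C.chart.source ∩ C.chart ⁻¹' Metric.ball 0 δ
  have hSdiv : ∀ g ∈ S, ∀ x ∈ S, g⁻¹ * x ∈ C.chart.source := fun g hg x hx => by
    have := hdiv _ hg.2 _ hx.2
    rwa [C.chart.left_inv hg.1, C.chart.left_inv hx.1] at this
  -- a neighbourhood of `1` with `S₂ * S₂ ⊆ S`, and its `K`-invariant part
  obtain ⟨S₂, hS₂, hS₂1, hS₂S⟩ := exists_open_nhds_one_mul_subset ((hball δ hδ).1.mem_nhds
    (hball δ hδ).2)
  have hS₃ : IsOpen {g | ∀ k, σ k * g * (σ k)⁻¹ ∈ S₂} :=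
    isOpen_forall_mem_of_compactSpace (f := fun p : K × G => σ p.1 * p.2 * (σ p.1)⁻¹)
      (by fun_prop) hS₂
  obtain ⟨η, hη, hηδ, hηS⟩ : ∃ η > 0, η < δ ∧
      ∀ u ∈ Metric.closedBall (0 : EuclideanSpace ℝ (Fin d)) η, ∀ k, σ k * C.chart.symm u * (σ k)⁻¹ ∈ S₂ := by
    have h0 : ContinuousAt C.chart.symm 0 := C.chart.symm.continuousAt C.zero_mem_target
    have h1 := h0.preimage_mem_nhds (hS₃.mem_nhds (by
      rw [C.symm_zero]; intro k; simpa using hS₂1))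
    obtain ⟨a, ha, h3⟩ := Metric.nhds_basis_closedBall.mem_iff.1 h1
    refine ⟨min a (δ / 2), by positivity, (min_le_right _ _).trans_lt (by linarith),
      fun u hu => h3 (Metric.closedBall_subset_closedBall (min_le_left _ _) hu)⟩
  -- Three requirements on x(k) = ρ(k)σ(k)⁻¹: S₂ keeps the translated centre in S, S keeps the chart
  -- defined at g⁻¹x(k), and the radius η/2 puts 0 within reach of the surjectivity estimate.
  refine ⟨S₂ ∩ (S ∩ (C.chart.source ∩ C.chart ⁻¹' Metric.ball 0 (η / 2))),
    hS₂.inter ((hball δ hδ).1.inter (hball _ (half_pos hη)).1),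
    ⟨hS₂1, (hball δ hδ).2, (hball _ (half_pos hη)).2⟩, fun ρ hρ hρV => ?_⟩
  let x : K → G := fun k => ρ k * (σ k)⁻¹
  have hxc : Continuous x := by fun_prop
  have hxS : ∀ k, x k ∈ S := fun k => (hρV k).2.1
  -- A zero of Ψ is a centre of mass of the values of x. In the chart, Ψ is minus the identity up to
  -- a map with Lipschitz constant 1/2, which gives both existence and uniqueness of a zero.
  let Ψ : G → EuclideanSpace ℝ (Fin d) := fun g => ∫ k, C.chart (g⁻¹ * x k) ∂μ
  have hΨc : ∀ g ∈ S, Continuous fun k => C.chart (g⁻¹ * x k) := fun g hg =>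
    C.chart.continuousOn.comp_continuous (f := fun k => g⁻¹ * x k) (by fun_prop)
      fun k => hSdiv g hg _ (hxS k)
  have hΨ : ∀ g ∈ S, ∀ g' ∈ S, ‖Ψ g - Ψ g' + (C.chart g - C.chart g')‖ ≤
      1 / 2 * ‖C.chart g - C.chart g'‖ := fun g hg g' hg' => by
    have e : Ψ g - Ψ g' + (C.chart g - C.chart g') = ∫ k, (C.chart (g⁻¹ * x k) -
        C.chart (g'⁻¹ * x k) + (C.chart g - C.chart g')) ∂μ := by
      have i1 := (hΨc g hg).integrable_of_compactSpace μ
      have i2 := (hΨc g' hg').integrable_of_compactSpace μ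
      rw [integral_add (f := fun k => C.chart (g⁻¹ * x k) - C.chart (g'⁻¹ * x k)) (i1.sub i2)
        (integrable_const _), integral_sub i1 i2]
      simp [Ψ]
    rw [e]
    refine (norm_integral_le_of_norm_le_const (C := 1 / 2 * ‖C.chart g - C.chart g'‖)
      (Filter.Eventually.of_forall fun k => ?_)).trans (by simp)
    have hp : ∀ h ∈ S, (C.chart h, C.chart (x k)) ∈ s := fun h hh => hδs (by
      rw [← ball_prod_same]
      exact ⟨Metric.ball_subset_ball hδδ₁ hh.2, Metric.ball_subset_ball hδδ₁ (hxS k).2⟩)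
    have := happ _ (hp g hg) _ (hp g' hg')
    simp only [C.chart.left_inv hg.1, C.chart.left_inv hg'.1, C.chart.left_inv (hxS k).1] at this
    simpa [Prod.norm_def, sub_sub_eq_add_sub, add_sub_assoc] using this
  -- the centre of mass
  obtain ⟨g, hgS, hgS₂, hg0⟩ : ∃ g ∈ S, (∀ k, σ k * g * (σ k)⁻¹ ∈ S₂) ∧ Ψ g = 0 := by
    have happ' : ApproximatesLinearOn (fun u => Ψ (C.chart.symm u))
        (-ContinuousLinearMap.id ℝ (EuclideanSpace ℝ (Fin d))) (Metric.ball 0 δ) (1 / 2) := fun u hu v hv => by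
      have hm : ∀ w ∈ Metric.ball (0 : EuclideanSpace ℝ (Fin d)) δ, C.chart.symm w ∈ S := fun w hw =>
        ⟨C.chart.map_target (htarget hw), by
          change C.chart (C.chart.symm w) ∈ Metric.ball 0 δ; rwa [C.chart.right_inv (htarget hw)]⟩
      have := hΨ _ (hm u hu) _ (hm v hv)
      rw [C.chart.right_inv (htarget hu), C.chart.right_inv (htarget hv)] at this
      simpa only [neg_apply, ContinuousLinearMap.id_apply, sub_neg_eq_add,
        NNReal.coe_div, NNReal.coe_one, NNReal.coe_ofNat] using this
    -- The inverse of -id has norm 1, so the image of the ball of radius η contains the ball of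
    -- radius (1 - 1/2)η around Ψ(1).
    have hsurj := happ'.surjOn_closedBall_of_nonlinearRightInverse
      ⟨fun u => -u, 1, fun u => by simp, fun u => by simp⟩ hη.le
      (Metric.closedBall_subset_ball hηδ)
    have h0 : (0 : EuclideanSpace ℝ (Fin d)) ∈ Metric.closedBall (Ψ (C.chart.symm 0))
        ((((1 : NNReal) : ℝ)⁻¹ - ((1 / 2 : NNReal) : ℝ)) * η) := by
      rw [Metric.mem_closedBall, dist_comm, dist_zero_right, C.symm_zero]
      refine (norm_integral_le_of_norm_le_const (C := η / 2)
        (Filter.Eventually.of_forall fun k => ?_)).trans ?_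
      · have := (hρV k).2.2.2
        rw [mem_preimage, Metric.mem_ball, dist_zero_right] at this
        simpa using this.le
      · simp; linarith
    obtain ⟨u, hu, hu0⟩ := hsurj h0
    have hut := htarget (Metric.closedBall_subset_ball hηδ hu)
    refine ⟨C.chart.symm u, ⟨C.chart.map_target hut, ?_⟩, hηS u hu, hu0⟩
    change C.chart (C.chart.symm u) ∈ Metric.ball 0 δ
    rw [C.chart.right_inv hut]
    exact Metric.closedBall_subset_ball hηδ hu
  refine ⟨g, fun k' => ?_⟩
  -- Since x(k'k) = x(k') σ(k') x(k) σ(k')⁻¹, the map h ↦ x(k') σ(k') h σ(k')⁻¹ = ρ(k') h σ(k')⁻¹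
  -- should carry a centre of mass to a centre of mass.
  have hg' : x k' * (σ k' * g * (σ k')⁻¹) ∈ S := hS₂S (mul_mem_mul (hρV k').1 (hgS₂ k'))
  have hg'0 : Ψ (x k' * (σ k' * g * (σ k')⁻¹)) = 0 := by
    have e : ∀ k, (x k' * (σ k' * g * (σ k')⁻¹))⁻¹ * x (k' * k) =
        σ k' * (g⁻¹ * x k) * (σ k')⁻¹ := fun k => by
      simp only [x, map_mul]; group
    change ∫ k, C.chart ((x k' * (σ k' * g * (σ k')⁻¹))⁻¹ * x k) ∂μ = 0
    rw [← integral_mul_left_eq_self _ k']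
    simp only [e]
    have e2 : ∀ k, C.chart (σ k' * (g⁻¹ * x k) * (σ k')⁻¹) = C.rep k' (C.chart (g⁻¹ * x k)) :=
      fun k => C.map_act k' _ (hSdiv g hgS _ (hxS k))
    simp only [e2]
    rw [ContinuousLinearMap.integral_comp_comm _ ((hΨc g hgS).integrable_of_compactSpace μ)]
    change C.rep k' (Ψ g) = 0
    rw [hg0, map_zero]
  -- At two zeros of Ψ the estimate bounds the distance of their coordinates by half of itself.
  have h := hΨ _ hg' g hgS
  rw [hg'0, hg0, sub_zero, zero_add] at h
  have h' : C.chart (x k' * (σ k' * g * (σ k')⁻¹)) = C.chart g := by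
    rw [← sub_eq_zero, ← norm_eq_zero]
    linarith [norm_nonneg (C.chart (x k' * (σ k' * g * (σ k')⁻¹)) - C.chart g)]
  have h'' := C.chart.injOn hg'.1 hgS.1 h'
  rw [eq_mul_inv_iff_mul_eq, ← mul_inv_eq_iff_eq_mul]
  simpa [x, mul_assoc] using h''

end Conjugation

/-! ### Submanifolds from slice charts -/

section SmoothStructures

/-- The charted space structure given by a chart around each point. -/
abbrev chartedSpaceOfCharts {H Y : Type*} [TopologicalSpace H] [TopologicalSpace Y]
    (F : Y → OpenPartialHomeomorph Y H) (hF : ∀ y, y ∈ (F y).source) : ChartedSpace H Y where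
  atlas := range F
  chartAt := F
  mem_chart_source := hF
  chart_mem_atlas := fun y => ⟨y, rfl⟩

theorem isManifold_chartedSpaceOfCharts {n : ℕ} {Y : Type*} [TopologicalSpace Y]
    (F : Y → OpenPartialHomeomorph Y (EuclideanSpace ℝ (Fin n))) (hF : ∀ y, y ∈ (F y).source)
    (h : ∀ y y', ContDiffOn ℝ ∞ ((F y).symm ≫ₕ F y') ((F y).symm ≫ₕ F y').source) :
    letI := chartedSpaceOfCharts F hF
    IsManifold (𝓡 n) ∞ Y := by
  let := chartedSpaceOfCharts F hF
  refine isManifold_of_contDiffOn _ _ _ ?_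
  rintro _ _ ⟨y, rfl⟩ ⟨y', rfl⟩
  simpa using h y y'

variable {M : Type*} {d : ℕ} [TopologicalSpace M] [ChartedSpace (EuclideanSpace ℝ (Fin d)) M]
  [IsManifold (𝓡 d) ∞ M]

open Classical in
/-- The chart of a subset `S` induced by a slice chart of the ambient manifold. -/
noncomputable def sliceChart {S : Set M} {k c : ℕ}
    (Φ : OpenPartialHomeomorph M (EuclideanSpace ℝ (Fin d)))
    (e : (EuclideanSpace ℝ (Fin k) × EuclideanSpace ℝ (Fin c)) ≃L[ℝ] EuclideanSpace ℝ (Fin d))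
    (hS : ∀ z ∈ Φ.source, z ∈ S ↔ (e.symm (Φ z)).2 = 0) (y : S) :
    OpenPartialHomeomorph S (EuclideanSpace ℝ (Fin k)) := by
  have hmem : ∀ w : EuclideanSpace ℝ (Fin k), e (w, 0) ∈ Φ.target → Φ.symm (e (w, 0)) ∈ S :=
    fun w hw => (hS _ (Φ.map_target hw)).2 (by rw [Φ.right_inv hw, e.symm_apply_apply])
  exact
  { toFun := fun z => (e.symm (Φ z)).1
    invFun := fun w => if h : e (w, 0) ∈ Φ.target then ⟨Φ.symm (e (w, 0)), hmem w h⟩ else y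
    source := Subtype.val ⁻¹' Φ.source
    target := {w | e (w, 0) ∈ Φ.target}
    map_source' := fun z hz => by
      have h0 : e ((e.symm (Φ z)).1, 0) = Φ z := by
        rw [← (hS z hz).1 z.2, Prod.mk.eta, e.apply_symm_apply]
      change e ((e.symm (Φ z)).1, 0) ∈ Φ.target
      rw [h0]; exact Φ.map_source hz
    map_target' := fun w hw => by
      have hw' : e (w, 0) ∈ Φ.target := hw
      simp [hw']
    left_inv' := fun z hz => by
      have h0 : e ((e.symm (Φ z)).1, 0) = Φ z := by
        rw [← (hS z hz).1 z.2, Prod.mk.eta, e.apply_symm_apply]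
      have h1 : e ((e.symm (Φ z)).1, 0) ∈ Φ.target := by rw [h0]; exact Φ.map_source hz
      rw [dif_pos h1]
      exact Subtype.ext ((congrArg Φ.symm h0).trans (Φ.left_inv hz))
    right_inv' := fun w hw => by
      have hw' : e (w, 0) ∈ Φ.target := hw
      simp only [dif_pos hw', Φ.right_inv hw', e.symm_apply_apply]
    open_source := Φ.open_source.preimage continuous_subtype_val
    open_target := Φ.open_target.preimage (by fun_prop)
    continuousOn_toFun := by
      have h : ContinuousOn (fun z : S => Φ z) (Subtype.val ⁻¹' Φ.source) :=
        Φ.continuousOn.comp continuous_subtype_val.continuousOn fun z hz => hz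
      exact continuous_fst.comp_continuousOn (e.symm.continuous.comp_continuousOn h)
    continuousOn_invFun := by
      rw [Topology.IsInducing.subtypeVal.continuousOn_iff]
      have h : ContinuousOn (fun w => Φ.symm (e (w, 0))) {w | e (w, 0) ∈ Φ.target} :=
        Φ.symm.continuousOn.comp (t := Φ.target) (by fun_prop) fun w hw => hw
      refine h.congr fun w hw => ?_
      have hw' : e (w, 0) ∈ Φ.target := hw
      simp [hw'] }

omit [IsManifold (𝓡 d) ∞ M] [ChartedSpace (EuclideanSpace ℝ (Fin d)) M] in
theorem coe_sliceChart_symm {S : Set M} {k c : ℕ}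
    {Φ : OpenPartialHomeomorph M (EuclideanSpace ℝ (Fin d))}
    {e : (EuclideanSpace ℝ (Fin k) × EuclideanSpace ℝ (Fin c)) ≃L[ℝ] EuclideanSpace ℝ (Fin d)}
    (hS : ∀ z ∈ Φ.source, z ∈ S ↔ (e.symm (Φ z)).2 = 0) (y : S) {w : EuclideanSpace ℝ (Fin k)}
    (hw : w ∈ (sliceChart Φ e hS y).target) :
    ((sliceChart Φ e hS y).symm w : M) = Φ.symm (e (w, 0)) := by
  have hw' : e (w, 0) ∈ Φ.target := hw
  exact congrArg Subtype.val (dif_pos hw')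

/-- A subset with a slice chart around each of its points is an embedded submanifold. -/
theorem exists_isSmoothEmbedding_subtypeVal {S : Set M} {k c : ℕ}
    (h : ∀ y : S, ∃ (Φ : OpenPartialHomeomorph M (EuclideanSpace ℝ (Fin d)))
      (e : (EuclideanSpace ℝ (Fin k) × EuclideanSpace ℝ (Fin c)) ≃L[ℝ] EuclideanSpace ℝ (Fin d)),
      (y : M) ∈ Φ.source ∧ ContMDiffOn (𝓡 d) (𝓡 d) ∞ Φ Φ.source ∧
      ContMDiffOn (𝓡 d) (𝓡 d) ∞ Φ.symm Φ.target ∧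
      ∀ z ∈ Φ.source, z ∈ S ↔ (e.symm (Φ z)).2 = 0) :
    ∃ (_ : ChartedSpace (EuclideanSpace ℝ (Fin k)) S), IsManifold (𝓡 k) ∞ S ∧
      Manifold.IsSmoothEmbedding (𝓡 k) (𝓡 d) ∞ (Subtype.val : S → M) := by
  choose Φ e hy hΦ hΦ' hS using h
  let F : S → OpenPartialHomeomorph S (EuclideanSpace ℝ (Fin k)) :=
    fun y => sliceChart (Φ y) (e y) (hS y) y
  have hF : ∀ y, y ∈ (F y).source := hy
  have hm := isManifold_chartedSpaceOfCharts F hF (fun y y' => by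
    have h1 : ContMDiffOn (𝓡 k) (𝓡 k) ∞ (fun w => ((e y').symm (Φ y' ((Φ y).symm
        (e y (w, 0))))).1) ((F y).symm ≫ₕ F y').source := by
      have a1 : ContMDiffOn (𝓡 k) (𝓡 d) ∞ (fun w => (Φ y).symm (e y (w, 0)))
          ((F y).symm ≫ₕ F y').source := by
        refine (hΦ' y).comp (f := fun w => e y (w, 0)) ?_ fun w hw => ?_
        · rw [contMDiffOn_iff_contDiffOn]; fun_prop
        · exact hw.1
      have a2 : ContMDiffOn (𝓡 k) (𝓡 d) ∞ (fun w => Φ y' ((Φ y).symm (e y (w, 0))))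
          ((F y).symm ≫ₕ F y').source := by
        refine (hΦ y').comp a1 fun w hw => ?_
        have h2 : ((F y).symm w : M) ∈ (Φ y').source := hw.2
        rwa [coe_sliceChart_symm (hS y) y hw.1] at h2
      rw [contMDiffOn_iff_contDiffOn] at a2 ⊢
      exact contDiff_fst.comp_contDiffOn ((e y').symm.contDiff.comp_contDiffOn a2)
    rw [contMDiffOn_iff_contDiffOn] at h1
    refine h1.congr fun w hw => ?_
    change ((e y').symm (Φ y' ((F y).symm w : M))).1 = _
    rw [coe_sliceChart_symm (hS y) y hw.1])
  let cs := chartedSpaceOfCharts F hF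
  refine ⟨cs, hm, ⟨⟨EuclideanSpace ℝ (Fin c), inferInstance, inferInstance, fun y => ?_⟩,
    Topology.IsEmbedding.subtypeVal⟩⟩
  -- In the charts `F y` and `Φ y` the inclusion is w ↦ e (w, 0), the normal form of an immersion.
  refine Manifold.IsImmersionAtOfComplement.mk_of_charts (e y) (F y) (Φ y) (hF y) (hy y) ?_ ?_
    (fun z hz => hz) ?_
  · exact IsManifold.subset_maximalAtlas ⟨y, rfl⟩
  · exact OpenPartialHomeomorph.mem_maximalAtlas_of_contMDiffOn _ (hΦ y) (hΦ' y)
  · intro w hw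
    have hw' : w ∈ (F y).target := by simpa using hw
    have hw'' : e y (w, 0) ∈ (Φ y).target := hw'
    simp only [Function.comp_apply, OpenPartialHomeomorph.extend_coe,
      OpenPartialHomeomorph.extend_coe_symm, modelWithCornersSelf_coe, modelWithCornersSelf_coe_symm, id]
    rw [coe_sliceChart_symm (hS y) y hw', (Φ y).right_inv hw'']

/-! ### Quotient manifolds from local sections -/

section Quotient

variable {EX HX X Y : Type*} [NormedAddCommGroup EX] [NormedSpace ℝ EX] [TopologicalSpace HX]
  {I : ModelWithCorners ℝ EX HX} [TopologicalSpace X] [ChartedSpace HX X]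
  [TopologicalSpace Y] {n : ℕ}

/-- A chart of a quotient, given by a smooth map `r` whose fibres near a point are those of the
quotient map `q`, and a smooth section `s` of `r`. -/
theorem exists_chart_of_isOpenMap {q : X → Y} (hq : Continuous q) (hqo : IsOpenMap q)
    {N : Set X} (hN : IsOpen N) {r : X → EuclideanSpace ℝ (Fin n)} (hr : ContinuousOn r N)
    {s : EuclideanSpace ℝ (Fin n) → X} {B : Set (EuclideanSpace ℝ (Fin n))} (hB : IsOpen B)
    (hs : ContinuousOn s B) (hsN : ∀ v ∈ B, s v ∈ N) (hrs : ∀ v ∈ B, r (s v) = v)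
    (hqr : ∀ a ∈ N, ∀ b ∈ N, q a = q b ↔ r a = r b) :
    ∃ F : OpenPartialHomeomorph Y (EuclideanSpace ℝ (Fin n)), F.target = B ∧
      (∀ v, F.symm v = q (s v)) ∧ (∀ a ∈ N, r a ∈ B → q a ∈ F.source ∧ F (q a) = r a) ∧
      ∀ y ∈ F.source, ∃ a ∈ N, r a ∈ B ∧ q a = y := by
  have hqs : ∀ a ∈ N, r a ∈ B → q (s (r a)) = q a := fun a ha hab =>
    (hqr _ (hsN _ hab) _ ha).2 (hrs _ hab)
  have hinj : InjOn (q ∘ s) B := fun v hv w hw h => by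
    rw [← hrs v hv, ← hrs w hw]
    exact (hqr _ (hsN _ hv) _ (hsN _ hw)).1 h
  -- The image of O under q ∘ s is also the image under the open map q of an open set; this is why q
  -- ∘ s is open although s is only a section.
  have himage : ∀ O, O ⊆ B → (q ∘ s) '' O = q '' (N ∩ r ⁻¹' O) := fun O hO => by
    ext y
    constructor
    · rintro ⟨v, hv, rfl⟩
      exact ⟨s v, ⟨hsN v (hO hv), by rw [mem_preimage, hrs v (hO hv)]; exact hv⟩, rfl⟩
    · rintro ⟨a, ⟨ha, hab⟩, rfl⟩
      exact ⟨r a, hab, hqs a ha (hO hab)⟩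
  have hopen : ∀ O, IsOpen O → O ⊆ B → IsOpen ((q ∘ s) '' O) := fun O hO hOB => by
    rw [himage O hOB]
    exact hqo _ (hr.isOpen_inter_preimage hN hO)
  let e := OpenPartialHomeomorph.ofContinuousOpenRestrict (hinj.bijOn_image.toPartialEquiv (q ∘ s) B _)
    (hq.comp_continuousOn hs) (fun O hO => by
      have h1 : (B.domRestrict (q ∘ s)) '' O = (q ∘ s) '' (Subtype.val '' O) := by
        rw [image_image]; rfl
      change IsOpen ((B.domRestrict (q ∘ s)) '' O)
      rw [h1]
      exact hopen _ (hB.isOpenMap_subtype_val O hO) (by rintro _ ⟨v, -, rfl⟩; exact v.2)) hB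
  have key : ∀ a ∈ N, r a ∈ B → q a ∈ e.target ∧ e.symm (q a) = r a := fun a ha hab => by
    have h1 : e (r a) = q a := hqs a ha hab
    rw [← h1]
    exact ⟨e.map_source hab, e.left_inv hab⟩
  refine ⟨e.symm, rfl, fun v => rfl, key, fun y hy => ?_⟩
  have h1 : y ∈ (q ∘ s) '' B := hy
  rw [himage B subset_rfl] at h1
  obtain ⟨a, ha, rfl⟩ := h1
  exact ⟨a, ha.1, ha.2, rfl⟩

/-- The quotient of a manifold by a group of diffeomorphisms, here given by its quotient map `q`,
is a manifold if the fibres of `q` are locally those of smooth maps with smooth sections. -/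
theorem exists_isSmoothSubmersion_of_isOpenMap {q : X → Y} (hq : Continuous q)
    (hqo : IsOpenMap q) (hqs : Function.Surjective q)
    (hτ : ∀ a b, q a = q b → ∃ τ : X → X, ContMDiff I I ∞ τ ∧ (∀ x, q (τ x) = q x) ∧ τ a = b)
    (hr : ∀ p : X, ∃ (N : Set X) (r : X → EuclideanSpace ℝ (Fin n))
      (s : EuclideanSpace ℝ (Fin n) → X) (B : Set (EuclideanSpace ℝ (Fin n))), IsOpen N ∧ p ∈ N ∧
      ContMDiffOn I (𝓡 n) ∞ r N ∧ IsOpen B ∧ r p ∈ B ∧ s (r p) = p ∧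
      ContMDiffOn (𝓡 n) I ∞ s B ∧ (∀ v ∈ B, r (s v) = v) ∧
      ∀ a ∈ N, ∀ b ∈ N, q a = q b ↔ r a = r b) :
    ∃ (_ : ChartedSpace (EuclideanSpace ℝ (Fin n)) Y), IsManifold (𝓡 n) ∞ Y ∧
      IsSmoothSubmersion I (𝓡 n) q := by
  have hr' : ∀ y : Y, ∃ (p : X) (N : Set X) (r : X → EuclideanSpace ℝ (Fin n))
      (s : EuclideanSpace ℝ (Fin n) → X) (B : Set (EuclideanSpace ℝ (Fin n)))
      (F : OpenPartialHomeomorph Y (EuclideanSpace ℝ (Fin n))), q p = y ∧ p ∈ N ∧ IsOpen N ∧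
      ContMDiffOn I (𝓡 n) ∞ r N ∧ IsOpen B ∧ r p ∈ B ∧ s (r p) = p ∧ ContMDiffOn (𝓡 n) I ∞ s B ∧
      F.target = B ∧ (∀ v, F.symm v = q (s v)) ∧
      (∀ a ∈ N, r a ∈ B → q a ∈ F.source ∧ F (q a) = r a) ∧
      ∀ y ∈ F.source, ∃ a ∈ N, r a ∈ B ∧ q a = y := fun y => by
    obtain ⟨p, rfl⟩ := hqs y
    obtain ⟨N, r, s, B, hN, hp, hr, hB, hpB, hsp, hs, hrs, hqr⟩ := hr p
    -- Shrinking B keeps the section inside N, where q and r have the same fibres.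
    have hB' : IsOpen (B ∩ s ⁻¹' N) := hs.continuousOn.isOpen_inter_preimage hB hN
    obtain ⟨F, hF1, hF2, hF3, hF4⟩ := exists_chart_of_isOpenMap hq hqo hN hr.continuousOn hB'
      (hs.continuousOn.mono inter_subset_left) (fun v hv => hv.2) (fun v hv => hrs v hv.1) hqr
    exact ⟨p, N, r, s, B ∩ s ⁻¹' N, F, rfl, hp, hN, hr, hB', ⟨hpB, by rwa [mem_preimage, hsp]⟩, hsp,
      hs.mono inter_subset_left, hF1, hF2, hF3, hF4⟩
  choose p N r s B F hqp hpN hN hr hB hpB hsp hs hFt hFs hF hF' using hr'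
  have hFsrc : ∀ y, y ∈ (F y).source := fun y => by
    have := (hF y _ (hpN y) (hpB y)).1
    rwa [hqp] at this
  -- The point x may lie outside N; a smooth map τ preserving the fibres of q moves it into N, and
  -- there F ∘ q is r.
  have hFq : ∀ y x, q x ∈ (F y).source → ContMDiffAt I (𝓡 n) ∞ (fun x => F y (q x)) x :=
    fun y x hx => by
    obtain ⟨a, ha, hab, hqa⟩ := hF' y _ hx
    obtain ⟨τ, hτ, hqτ, hτx⟩ := hτ x a hqa.symm
    have hopen : IsOpen (N y ∩ r y ⁻¹' B y) := (hr y).continuousOn.isOpen_inter_preimage (hN y) (hB y)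
    have h1 : ContMDiffAt I (𝓡 n) ∞ (fun x => r y (τ x)) x :=
      ContMDiffAt.comp x ((hr y).contMDiffAt ((hN y).mem_nhds (by rwa [hτx]))) hτ.contMDiffAt
    refine h1.congr_of_eventuallyEq ?_
    filter_upwards [hτ.continuous.continuousAt.preimage_mem_nhds
      (hopen.mem_nhds (show τ x ∈ _ by rw [hτx]; exact ⟨ha, hab⟩))] with z hz
    rw [← (hF y _ hz.1 hz.2).2, hqτ]
  have hm := isManifold_chartedSpaceOfCharts F hFsrc (fun y y' => by
    rw [← contMDiffOn_iff_contDiffOn]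
    intro v hv
    have hvB : v ∈ B y := by rw [← hFt y]; exact hv.1
    have hv2 : q (s y v) ∈ (F y').source := by rw [← hFs]; exact hv.2
    have h1 : ContMDiffAt (𝓡 n) (𝓡 n) ∞ (fun v => F y' (q (s y v))) v :=
      ContMDiffAt.comp v (g := fun x => F y' (q x)) (hFq y' _ hv2)
        ((hs y).contMDiffAt ((hB y).mem_nhds hvB))
    refine (h1.congr_of_eventuallyEq (Filter.Eventually.of_forall fun w => ?_)).contMDiffWithinAt
    simp [hFs])
  let cs := chartedSpaceOfCharts F hFsrc
  have hmax : ∀ y, F y ∈ IsManifold.maximalAtlas (𝓡 n) ∞ Y := fun y =>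
    IsManifold.subset_maximalAtlas ⟨y, rfl⟩
  have hq_smooth : ContMDiff I (𝓡 n) ∞ q := fun x => by
    have h1 : ContMDiffAt I (𝓡 n) ∞ (fun z => (F (q x)).symm (F (q x) (q z))) x :=
      ContMDiffAt.comp x (g := (F (q x)).symm) (contMDiffAt_symm_of_mem_maximalAtlas (hmax (q x))
        ((F (q x)).map_source (hFsrc _))) (hFq _ x (hFsrc _))
    refine h1.congr_of_eventuallyEq ?_
    filter_upwards [hq.continuousAt.preimage_mem_nhds ((F (q x)).open_source.mem_nhds
      (hFsrc (q x)))] with z hz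
    exact ((F (q x)).left_inv hz).symm
  refine ⟨cs, hm, hq_smooth, fun x => ?_⟩
  obtain ⟨τ, hτ, hqτ, hτx⟩ := hτ (p (q x)) x (hqp _)
  have hFx : F (q x) (q x) = r (q x) (p (q x)) := by
    have := (hF (q x) _ (hpN _) (hpB _)).2
    rwa [hqp] at this
  have hσx : τ (s (q x) (F (q x) (q x))) = x := by rw [hFx, hsp, hτx]
  -- A smooth local section of q whose value at q x is x itself; its derivative is a right inverse
  -- of that of q.
  have hσ : ContMDiffAt (𝓡 n) I ∞ (fun y => τ (s (q x) (F (q x) y))) (q x) := by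
    refine hτ.contMDiffAt.comp _ (ContMDiffAt.comp (q x) (g := s (q x)) ?_
      (contMDiffAt_of_mem_maximalAtlas (hmax _) (hFsrc _)))
    refine (hs _).contMDiffAt ((hB _).mem_nhds ?_)
    rw [hFx]; exact hpB _
  have hd := mfderiv_comp (I := 𝓡 n) (I' := I) (I'' := 𝓡 n) (q x) (g := q)
    (f := fun y => τ (s (q x) (F (q x) y))) (hq_smooth.mdifferentiable (by simp) _)
    (hσ.mdifferentiableAt (by simp))
  have hid : mfderiv (𝓡 n) (𝓡 n) (q ∘ fun y => τ (s (q x) (F (q x) y))) (q x) =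
      ContinuousLinearMap.id ℝ _ := by
    rw [← mfderiv_id]
    refine Filter.EventuallyEq.mfderiv_eq ?_
    filter_upwards [(F (q x)).open_source.mem_nhds (hFsrc (q x))] with y hy
    simp only [Function.comp_apply, hqτ, ← hFs, (F (q x)).left_inv hy, id]
  rw [hid] at hd
  have h : Function.Surjective (mfderiv I (𝓡 n) q (τ (s (q x) (F (q x) (q x))))) := fun v =>
    ⟨mfderiv (𝓡 n) I (fun y => τ (s (q x) (F (q x) y))) (q x) v, (DFunLike.congr_fun hd v).symm⟩
  rwa [hσx] at h

end Quotient

end SmoothStructures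

/-! ### Dimension and local connectedness of the fixed point set -/

/-- The splitting into range and kernel of a projection. The rank is a separate variable k so that
the charts at different points can use the same model spaces. -/
theorem exists_continuousLinearEquiv_of_proj {d k : ℕ}
    {P : EuclideanSpace ℝ (Fin d) →L[ℝ] EuclideanSpace ℝ (Fin d)} (hP : ∀ u, P (P u) = P u)
    (hk : Module.finrank ℝ P.range = k) :
    ∃ e : (EuclideanSpace ℝ (Fin k) × EuclideanSpace ℝ (Fin (d - k))) ≃L[ℝ]
      EuclideanSpace ℝ (Fin d), ∀ u, (e.symm u).2 = 0 ↔ P u = u := by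
  have hc : IsCompl P.range (P : EuclideanSpace ℝ (Fin d) →ₗ[ℝ] EuclideanSpace ℝ (Fin d)).ker := by
    have h := LinearMap.isCompl_of_proj (p := P.range)
      (f := (P : EuclideanSpace ℝ (Fin d) →ₗ[ℝ] EuclideanSpace ℝ (Fin d)).rangeRestrict)
      (by rintro ⟨_, u, rfl⟩; exact Subtype.ext (hP u))
    rwa [LinearMap.ker_rangeRestrict] at h
  have hq : Module.finrank ℝ (P : EuclideanSpace ℝ (Fin d) →ₗ[ℝ] EuclideanSpace ℝ (Fin d)).ker =
      d - k := by
    have := Submodule.finrank_add_eq_of_isCompl hc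
    rw [finrank_euclideanSpace_fin, hk] at this
    omega
  let e₁ := LinearEquiv.ofFinrankEq (EuclideanSpace ℝ (Fin k)) P.range
    (by rw [finrank_euclideanSpace_fin]; exact hk.symm)
  let e₂ := LinearEquiv.ofFinrankEq (EuclideanSpace ℝ (Fin (d - k)))
    (P : EuclideanSpace ℝ (Fin d) →ₗ[ℝ] EuclideanSpace ℝ (Fin d)).ker
    (by rw [finrank_euclideanSpace_fin]; exact hq.symm)
  let e := (e₁.prodCongr e₂).trans (Submodule.prodEquivOfIsCompl _ _ hc)
  refine ⟨e.toContinuousLinearEquiv, fun u => ?_⟩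
  have h1 : (e.toContinuousLinearEquiv.symm u).2 =
    e₂.symm ((Submodule.prodEquivOfIsCompl _ _ hc).symm u).2 := rfl
  rw [h1, LinearEquiv.map_eq_zero_iff, Submodule.prodEquivOfIsCompl_symm_apply_snd_eq_zero]
  constructor
  · rintro ⟨w, rfl⟩
    exact hP w
  · intro h
    exact ⟨u, h⟩

namespace EquivariantChart

variable {K M : Type*} {d : ℕ} [TopologicalSpace K]
  [TopologicalSpace M] [ChartedSpace (EuclideanSpace ℝ (Fin d)) M] {act : K → M → M} {y y' : M}

/-- Read in the charts, the derivative of the equivariant map θ at a fixed point is injective and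
intertwines the representations, so it embeds fixed vectors into fixed vectors. The point z need not
be a centre of either chart, so with θ = id this also compares overlapping charts. -/
theorem finrank_range_proj_le (C : EquivariantChart d act y) (C' : EquivariantChart d act y')
    {θ θ' : M → M} (hθ : ContMDiff (𝓡 d) (𝓡 d) ∞ θ) (hθ' : ContMDiff (𝓡 d) (𝓡 d) ∞ θ')
    (hθθ' : ∀ z, θ' (θ z) = z) (hact : ∀ k z, θ (act k z) = act k (θ z)) {z : M}
    (hz : z ∈ C.chart.source) (hz' : θ z ∈ C'.chart.source) (hfix : ∀ k, act k z = z) :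
    Module.finrank ℝ C.proj.range ≤ Module.finrank ℝ C'.proj.range := by
  have hv : C.chart z ∈ C.chart.target := C.chart.map_source hz
  have hvz : C.chart.symm (C.chart z) = z := C.chart.left_inv hz
  let f : EuclideanSpace ℝ (Fin d) → EuclideanSpace ℝ (Fin d) :=
    fun u => C'.chart (θ (C.chart.symm u))
  let g : EuclideanSpace ℝ (Fin d) → EuclideanSpace ℝ (Fin d) :=
    fun u => C.chart (θ' (C'.chart.symm u))
  have hf : ContMDiffAt (𝓡 d) (𝓡 d) ∞ f (C.chart z) := by
    refine ContMDiffAt.comp (C.chart z) (g := C'.chart) ?_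
      (hθ.contMDiffAt.comp (C.chart z) (C.contMDiffAt_symm hv))
    exact C'.contMDiffAt (by rwa [hvz])
  have hfz : f (C.chart z) = C'.chart (θ z) := by simp only [f, hvz]
  have hg : ContMDiffAt (𝓡 d) (𝓡 d) ∞ g (f (C.chart z)) := by
    rw [hfz]
    refine ContMDiffAt.comp _ (g := C.chart) ?_
      (hθ'.contMDiffAt.comp _ (C'.contMDiffAt_symm (C'.chart.map_source hz')))
    exact C.contMDiffAt (by rwa [C'.chart.left_inv hz', hθθ'])
  rw [contMDiffAt_iff_contDiffAt] at hf hg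
  obtain ⟨T, hT⟩ : ∃ T, HasFDerivAt f T (C.chart z) :=
    ⟨_, (hf.differentiableAt (by simp)).hasFDerivAt⟩
  obtain ⟨T', hT'⟩ : ∃ T', HasFDerivAt g T' (f (C.chart z)) :=
    ⟨_, (hg.differentiableAt (by simp)).hasFDerivAt⟩
  have hnear : ∀ᶠ u in 𝓝 (C.chart z), u ∈ C.chart.target ∧ θ (C.chart.symm u) ∈ C'.chart.source := by
    refine (C.chart.open_target.eventually_mem hv).and ?_
    refine (hθ.continuous.continuousAt.comp (C.chart.symm.continuousAt hv)).eventually_mem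
      (C'.chart.open_source.mem_nhds ?_)
    rwa [Function.comp_apply, hvz]
  have hTT' : ∀ w, T' (T w) = w := fun w => by
    have h1 := hT'.comp (C.chart z) hT
    have h2 : HasFDerivAt (g ∘ f) (ContinuousLinearMap.id ℝ _) (C.chart z) := by
      refine (hasFDerivAt_id _).congr_of_eventuallyEq ?_
      filter_upwards [hnear] with u hu
      simp only [g, f, Function.comp_apply, C'.chart.left_inv hu.2, hθθ', C.chart.right_inv hu.1, id]
    exact DFunLike.congr_fun (h1.unique h2) w
  have hrep : ∀ k, C.rep k (C.chart z) = C.chart z := fun k => by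
    rw [← C.map_act k z hz, hfix]
  have hTrep : ∀ k w, T (C.rep k w) = C'.rep k (T w) := fun k w => by
    have h1 : HasFDerivAt (fun u => f (C.rep k u)) (T.comp (C.rep k)) (C.chart z) := by
      refine HasFDerivAt.comp (C.chart z) (g := f) ?_ (C.rep k).hasFDerivAt
      rwa [hrep]
    have h2 : HasFDerivAt (fun u => C'.rep k (f u)) ((C'.rep k).comp T) (C.chart z) :=
      (C'.rep k).hasFDerivAt.comp _ hT
    have h3 : HasFDerivAt (fun u => f (C.rep k u)) ((C'.rep k).comp T) (C.chart z) := by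
      refine h2.congr_of_eventuallyEq ?_
      filter_upwards [hnear] with u hu
      have hs := C.chart.map_target hu.1
      have e1 : C.rep k u = C.chart (act k (C.chart.symm u)) := by
        rw [C.map_act k _ hs, C.chart.right_inv hu.1]
      change C'.chart (θ (C.chart.symm (C.rep k u))) = _
      rw [e1, C.chart.left_inv (C.act_mem k _ hs), hact, C'.map_act k _ hu.2]
    exact DFunLike.congr_fun (h1.unique h3) w
  have hmaps : ∀ w ∈ C.proj.range, T w ∈ C'.proj.range := by
    rintro _ ⟨w, rfl⟩
    refine ⟨T (C.proj w), C'.proj_eq _ fun k => ?_⟩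
    rw [← hTrep, C.rep_proj]
  refine LinearMap.finrank_le_finrank_of_injective
    (f := (T : EuclideanSpace ℝ (Fin d) →ₗ[ℝ] EuclideanSpace ℝ (Fin d)).restrict hmaps) ?_
  intro a b hab
  have h := congrArg Subtype.val hab
  exact Subtype.ext (by rw [← hTT' a, ← hTT' b]; exact congrArg T' h)

theorem finrank_range_proj_eq (C : EquivariantChart d act y) (C' : EquivariantChart d act y')
    {θ θ' : M → M} (hθ : ContMDiff (𝓡 d) (𝓡 d) ∞ θ) (hθ' : ContMDiff (𝓡 d) (𝓡 d) ∞ θ')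
    (hθθ' : ∀ z, θ' (θ z) = z) (hθ'θ : ∀ z, θ (θ' z) = z)
    (hact : ∀ k z, θ (act k z) = act k (θ z)) {z : M}
    (hz : z ∈ C.chart.source) (hz' : θ z ∈ C'.chart.source) (hfix : ∀ k, act k z = z) :
    Module.finrank ℝ C.proj.range = Module.finrank ℝ C'.proj.range := by
  refine le_antisymm (finrank_range_proj_le C C' hθ hθ' hθθ' hact hz hz' hfix)
    (finrank_range_proj_le C' C hθ' hθ hθ'θ (fun k w => ?_) hz' (by rwa [hθθ']) fun k => ?_)
  · rw [← hθθ' (act k (θ' w)), hact, hθ'θ]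
  · rw [← hact, hfix]

/-- Near the centre of an equivariant chart, the set of fixed points is path-connected. -/
theorem exists_nhds_joinedIn (C : EquivariantChart d act y) :
    ∃ U : Set M, IsOpen U ∧ y ∈ U ∧ ∀ z ∈ U, (∀ k, act k z = z) →
      JoinedIn {z | ∀ k, act k z = z} y z := by
  obtain ⟨r, hr, hball⟩ := Metric.mem_nhds_iff.1 (C.chart.open_target.mem_nhds C.zero_mem_target)
  refine ⟨C.chart.source ∩ C.chart ⁻¹' Metric.ball 0 r,
    C.chart.isOpen_inter_preimage Metric.isOpen_ball, ⟨C.mem_source, ?_⟩, fun z hz hfix => ?_⟩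
  · simpa [C.map_eq_zero] using hr
  have hline : ∀ t ∈ unitInterval, t • C.chart z ∈ C.chart.target := fun t ht => by
    refine hball ?_
    have h1 : ‖C.chart z‖ < r := by simpa using hz.2
    rw [mem_ball_zero_iff, norm_smul, Real.norm_of_nonneg ht.1]
    exact (mul_le_of_le_one_left (norm_nonneg _) ht.2).trans_lt h1
  -- In the chart the fixed points form a linear subspace, so the segment from 0 consists of fixed
  -- points.
  refine JoinedIn.ofLine (f := fun t => C.chart.symm (t • C.chart z)) ?_ ?_ ?_ ?_
  · exact C.chart.symm.continuousOn.comp (by fun_prop) hline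
  · simp [C.symm_zero]
  · simp [C.chart.left_inv hz.1]
  · rintro _ ⟨t, ht, rfl⟩ k
    refine C.act_symm_of_proj_eq (hline t ht) ?_ k
    rw [map_smul, (C.forall_act_eq_iff hz.1).1 hfix]

/-- Charts centred at nearby points of a path of fixed points share a fixed point, so the rank is
locally constant along the path. -/
theorem finrank_range_proj_eq_of_joinedIn
    (hex : ∀ z, (∀ k, act k z = z) → Nonempty (EquivariantChart d act z))
    (C : EquivariantChart d act y) (C' : EquivariantChart d act y')
    (h : JoinedIn {z | ∀ k, act k z = z} y y') :
    Module.finrank ℝ C.proj.range = Module.finrank ℝ C'.proj.range := by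
  have hfix := h.somePath_mem
  have hid : ContMDiff (𝓡 d) (𝓡 d) ∞ (fun z : M => z) := contMDiff_id
  let c := fun t => Classical.choice (hex _ (hfix t))
  have hloc : IsLocallyConstant fun t => Module.finrank ℝ (c t).proj.range := by
    rw [IsLocallyConstant.iff_eventually_eq]
    intro t
    filter_upwards [h.somePath.continuous.continuousAt.preimage_mem_nhds
      ((c t).chart.open_source.mem_nhds (c t).mem_source)] with t' ht'
    exact (finrank_range_proj_eq (c t) (c t') hid hid (fun _ => rfl) (fun _ => rfl)
      (fun _ _ => rfl) ht' (c t').mem_source (hfix t')).symm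
  have h0 := finrank_range_proj_eq C (c 0) hid hid (fun _ => rfl) (fun _ => rfl)
    (fun _ _ => rfl) C.mem_source (by simpa using (c 0).mem_source) (by simpa using hfix 0)
  have h1 := finrank_range_proj_eq C' (c 1) hid hid (fun _ => rfl) (fun _ => rfl)
    (fun _ _ => rfl) C'.mem_source (by simpa using (c 1).mem_source) (by simpa using hfix 1)
  rw [h0, h1]
  exact hloc.apply_eq_of_preconnectedSpace 0 1

end EquivariantChart

/-! ### The saturated fixed point component as a closed submanifold -/

section FixedPoints

variable {K G M : Type*} [Group K] [TopologicalSpace K] [Group G] [TopologicalSpace G]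
  [MulAction G M] {x : M} (σ : K →ₜ* MulAction.stabilizer G x)

theorem mem_fixedPoints_imageSubgroup_iff {z : M} :
    z ∈ MulAction.fixedPoints (imageSubgroup σ) M ↔ ∀ k, (σ k : G) • z = z := by
  constructor
  · intro h k
    exact h ⟨σ k, ⟨σ k, ⟨k, rfl⟩, rfl⟩⟩
  · rintro h ⟨_, _, ⟨k, rfl⟩, rfl⟩
    exact h k

theorem fixedPoints_imageSubgroup :
    MulAction.fixedPoints (imageSubgroup σ) M = {z : M | ∀ k, (σ k : G) • z = z} :=
  Set.ext fun _ => mem_fixedPoints_imageSubgroup_iff σ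

theorem mem_imageCentralizer_iff {h : G} :
    h ∈ imageCentralizer σ ↔ ∀ k, (σ k : G) * h = h * σ k := by
  rw [Subgroup.mem_centralizer_iff]
  constructor
  · intro hh k
    exact hh _ ⟨σ k, ⟨k, rfl⟩, rfl⟩
  · rintro hh _ ⟨_, ⟨k, rfl⟩, rfl⟩
    exact hh k

theorem smul_comm_of_mem_imageCentralizer {h : G} (hh : h ∈ imageCentralizer σ) (k : K) (z : M) :
    h • (σ k : G) • z = (σ k : G) • h • z := by
  rw [← mul_smul, ← mul_smul, (mem_imageCentralizer_iff σ).1 hh k]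

variable [TopologicalSpace M] [ContinuousSMul G M]

theorem joinedIn_smul_imageCentralizer {h : G} (hh : h ∈ imageCentralizer σ) {y z : M}
    (hj : JoinedIn {z : M | ∀ k, (σ k : G) • z = z} y z) :
    JoinedIn {z : M | ∀ k, (σ k : G) • z = z} (h • y) (h • z) := by
  refine (hj.map (continuous_const_smul h)).mono ?_
  rintro _ ⟨w, hw, rfl⟩ k
  change (σ k : G) • h • w = h • w
  rw [← smul_comm_of_mem_imageCentralizer σ hh, hw]

/-- The centralizer commutes with σ(K), hence permutes the path-components of the fixed point set;
the saturation is the union of the path-components of the points h • x. -/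
theorem mem_satFix_iff {y : M} : y ∈ satFix σ ↔ ∃ h ∈ imageCentralizer σ,
    JoinedIn {z : M | ∀ k, (σ k : G) • z = z} (h • x) y := by
  simp only [satFix, saturation, fixComponent, mem_iUnion, fixedPoints_imageSubgroup]
  constructor
  · rintro ⟨a, ha, ⟨h, hh⟩, rfl⟩
    exact ⟨h, hh, joinedIn_smul_imageCentralizer σ hh ha⟩
  · rintro ⟨h, hh, hj⟩
    refine ⟨h⁻¹ • y, ?_, ⟨h, hh⟩, smul_inv_smul h y⟩
    have := joinedIn_smul_imageCentralizer σ (inv_mem hh) hj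
    rwa [inv_smul_smul] at this

theorem mem_satFix_self : x ∈ satFix σ :=
  (mem_satFix_iff σ).2 ⟨1, one_mem _, by
    rw [one_smul]; exact JoinedIn.refl fun k => (σ k).2⟩

theorem smul_eq_of_mem_satFix {y : M} (hy : y ∈ satFix σ) (k : K) : (σ k : G) • y = y := by
  obtain ⟨h, -, hj⟩ := (mem_satFix_iff σ).1 hy
  exact hj.target_mem k

theorem mem_satFix_of_joinedIn {y z : M} (hy : y ∈ satFix σ)
    (hj : JoinedIn {z : M | ∀ k, (σ k : G) • z = z} y z) : z ∈ satFix σ := by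
  obtain ⟨h, hh, hj'⟩ := (mem_satFix_iff σ).1 hy
  exact (mem_satFix_iff σ).2 ⟨h, hh, hj'.trans hj⟩

theorem smul_mem_satFix {h : G} (hh : h ∈ imageCentralizer σ) {y : M} (hy : y ∈ satFix σ) :
    h • y ∈ satFix σ := by
  obtain ⟨h', hh', hj⟩ := (mem_satFix_iff σ).1 hy
  refine (mem_satFix_iff σ).2 ⟨h * h', mul_mem hh hh', ?_⟩
  rw [mul_smul]
  exact joinedIn_smul_imageCentralizer σ hh hj

variable {d : ℕ} [ChartedSpace (EuclideanSpace ℝ (Fin d)) M]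
  (hex : ∀ z : M, (∀ k, (σ k : G) • z = z) →
    Nonempty (EquivariantChart d (fun (k : K) (z : M) => (σ k : G) • z) z))

include hex

/-- The fixed point set is locally path-connected, so a union of its path-components is open and
closed in it. -/
theorem exists_isOpen_mem_satFix_iff {y : M} (hy : ∀ k, (σ k : G) • y = y) :
    ∃ U : Set M, IsOpen U ∧ y ∈ U ∧ ∀ z ∈ U, (∀ k, (σ k : G) • z = z) →
      (z ∈ satFix σ ↔ y ∈ satFix σ) := by
  obtain ⟨C⟩ := hex y hy
  obtain ⟨U, hU, hyU, hj⟩ := C.exists_nhds_joinedIn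
  exact ⟨U, hU, hyU, fun z hz hfix => ⟨fun h => mem_satFix_of_joinedIn σ h (hj z hz hfix).symm,
    fun h => mem_satFix_of_joinedIn σ h (hj z hz hfix)⟩⟩

theorem isClosed_satFix [T2Space M] : IsClosed (satFix σ) := by
  have hF : IsClosed {z : M | ∀ k, (σ k : G) • z = z} := by
    simp only [ofPred_forall]
    exact isClosed_iInter fun k => isClosed_eq (continuous_const_smul _) continuous_id
  rw [← isOpen_compl_iff, isOpen_iff_mem_nhds]
  intro y hy
  by_cases hfix : ∀ k, (σ k : G) • y = y
  · obtain ⟨U, hU, hyU, h⟩ := exists_isOpen_mem_satFix_iff σ hex hfix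
    filter_upwards [hU.mem_nhds hyU] with z hz hzS
    exact hy ((h z hz (smul_eq_of_mem_satFix σ hzS)).1 hzS)
  · filter_upwards [hF.isOpen_compl.mem_nhds hfix] with z hz hzS
    exact hz (smul_eq_of_mem_satFix σ hzS)

/-- The other half of the clopen decomposition of the fixed point set; it is what makes the
component of σ̄(x) open. -/
theorem isClosed_fixed_diff_satFix [T2Space M] :
    IsClosed ({z : M | ∀ k, (σ k : G) • z = z} \ satFix σ) := by
  have hF : IsClosed {z : M | ∀ k, (σ k : G) • z = z} := by
    simp only [ofPred_forall]
    exact isClosed_iInter fun k => isClosed_eq (continuous_const_smul _) continuous_id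
  rw [← isOpen_compl_iff, isOpen_iff_mem_nhds]
  intro y hy
  by_cases hfix : ∀ k, (σ k : G) • y = y
  · obtain ⟨U, hU, hyU, h⟩ := exists_isOpen_mem_satFix_iff σ hex hfix
    filter_upwards [hU.mem_nhds hyU] with z hz hzS
    exact hy ⟨hfix, fun hyS => hzS.2 ((h z hz hzS.1).2 hyS)⟩
  · filter_upwards [hF.isOpen_compl.mem_nhds hfix] with z hz hzS
    exact hz hzS.1

/-- From x to h • x the rank is preserved by the equivariant diffeomorphism h, and from there to y
by following a path. -/
theorem finrank_range_proj_eq_of_mem_satFix {dG : ℕ} [ChartedSpace (EuclideanSpace ℝ (Fin dG)) G]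
    [ContMDiffSMul (𝓡 dG) (𝓡 d) ∞ G M]
    (C : EquivariantChart d (fun (k : K) (z : M) => (σ k : G) • z) x) {y : M}
    (C' : EquivariantChart d (fun (k : K) (z : M) => (σ k : G) • z) y) (hy : y ∈ satFix σ) :
    Module.finrank ℝ C'.proj.range = Module.finrank ℝ C.proj.range := by
  obtain ⟨h, hh, hj⟩ := (mem_satFix_iff σ).1 hy
  obtain ⟨C''⟩ := hex (h • x) hj.source_mem
  rw [← EquivariantChart.finrank_range_proj_eq_of_joinedIn hex C'' C' hj]
  have hs : ∀ g : G, ContMDiff (𝓡 d) (𝓡 d) ∞ fun z : M => g • z := fun g =>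
    ContMDiffSMul.contMDiff_const_smul (I := 𝓡 dG) g
  exact (C.finrank_range_proj_eq C'' (hs h) (hs h⁻¹) (fun z => inv_smul_smul h z)
    (fun z => smul_inv_smul h z) (fun k z => smul_comm_of_mem_imageCentralizer σ hh k z)
    C.mem_source C''.mem_source fun k => (σ k).2).symm

/-- The slice charts of the saturation of the fixed point component. -/
theorem exists_sliceChart_satFix {dG : ℕ} [ChartedSpace (EuclideanSpace ℝ (Fin dG)) G]
    [ContMDiffSMul (𝓡 dG) (𝓡 d) ∞ G M]
    (C : EquivariantChart d (fun (k : K) (z : M) => (σ k : G) • z) x) (y : satFix σ) :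
    ∃ (Φ : OpenPartialHomeomorph M (EuclideanSpace ℝ (Fin d)))
      (e : (EuclideanSpace ℝ (Fin (Module.finrank ℝ C.proj.range)) ×
        EuclideanSpace ℝ (Fin (d - Module.finrank ℝ C.proj.range))) ≃L[ℝ]
          EuclideanSpace ℝ (Fin d)),
      (y : M) ∈ Φ.source ∧ ContMDiffOn (𝓡 d) (𝓡 d) ∞ Φ Φ.source ∧
      ContMDiffOn (𝓡 d) (𝓡 d) ∞ Φ.symm Φ.target ∧
      ∀ z ∈ Φ.source, z ∈ satFix σ ↔ (e.symm (Φ z)).2 = 0 := by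
  obtain ⟨y, hy⟩ := y
  have hfix := smul_eq_of_mem_satFix σ hy
  obtain ⟨C'⟩ := hex y hfix
  obtain ⟨U, hU, hyU, h⟩ := exists_isOpen_mem_satFix_iff σ hex hfix
  obtain ⟨e, he⟩ := exists_continuousLinearEquiv_of_proj C'.proj_proj
    (finrank_range_proj_eq_of_mem_satFix σ hex (dG := dG) C C' hy)
  -- Inside U, being fixed and being in the saturation are the same, so the linear equation for
  -- fixed points describes the saturation.
  refine ⟨C'.chart.restrOpen U hU, e, ⟨C'.mem_source, hyU⟩,
    C'.contMDiffOn.mono fun z hz => hz.1, C'.contMDiffOn_symm.mono fun z hz => hz.1,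
    fun z hz => ?_⟩
  have e1 := C'.forall_act_eq_iff hz.1
  change _ ↔ (e.symm (C'.chart z)).2 = 0
  rw [he, ← e1]
  exact ⟨fun hzS => smul_eq_of_mem_satFix σ hzS, fun hzf => (h z hz.2 hzf).2 hy⟩

end FixedPoints

/-! ### The space of homomorphisms and the orbit map -/

/-- The shear (g, x) ↦ (g, g • x) is a homeomorphism, and projecting away the compact factor G is
closed. -/
theorem isClosedMap_smul_of_compactSpace (G X : Type*) [Group G] [TopologicalSpace G]
    [IsTopologicalGroup G] [CompactSpace G] [TopologicalSpace X] [MulAction G X]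
    [ContinuousSMul G X] : IsClosedMap fun p : G × X => p.1 • p.2 := by
  let e : G × X ≃ₜ G × X :=
    { toFun := fun p => (p.1, p.1 • p.2)
      invFun := fun p => (p.1, p.1⁻¹ • p.2)
      left_inv := fun p => by simp
      right_inv := fun p => by simp
      continuous_toFun := by fun_prop
      continuous_invFun := by fun_prop }
  exact isClosedMap_snd_of_compactSpace.comp e.isClosedMap

section HomSpace

variable {K G M : Type*} [Group K] [TopologicalSpace K] [Group G] [TopologicalSpace G]
  [IsTopologicalGroup G] [TopologicalSpace M] [MulAction G M] [ContinuousSMul G M]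

open TopGroupoid (Hom)

theorem TopGroupoid.Hom.continuous_map :
    Continuous (Hom.map : Hom K (actionGroupoid G M) → C(K, G × M)) := continuous_induced_dom

theorem TopGroupoid.Hom.isEmbedding_map :
    Topology.IsEmbedding (Hom.map : Hom K (actionGroupoid G M) → C(K, G × M)) :=
  ⟨⟨rfl⟩, fun _ _ h => Hom.ext_map fun k => DFunLike.congr_fun h k⟩

theorem TopGroupoid.Hom.map_snd (φ : Hom K (actionGroupoid G M)) (k : K) :
    (φ.map k).2 = φ.obj := φ.src_map k

theorem TopGroupoid.Hom.map_fst_smul_obj (φ : Hom K (actionGroupoid G M)) (k : K) :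
    (φ.map k).1 • φ.obj = φ.obj := by
  have := φ.tgt_map k
  change (φ.map k).1 • (φ.map k).2 = φ.obj at this
  rwa [φ.map_snd] at this

theorem smul_map (g : G) (φ : Hom K (actionGroupoid G M)) (k : K) :
    (g • φ).map k = (g * (φ.map k).1 * g⁻¹, g • φ.obj) := rfl

/-- The homomorphism `K → G` underlying a homomorphism `K → G ⋉ M`. -/
def TopGroupoid.Hom.groupHom (φ : Hom K (actionGroupoid G M)) : K →* G where
  toFun := fun k => (φ.map k).1
  map_one' := by rw [φ.map_one]; rfl
  map_mul' := fun k k' => by rw [φ.map_mul]; rfl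

theorem continuous_obj : Continuous (Hom.obj : Hom K (actionGroupoid G M) → M) := by
  have h : (Hom.obj : Hom K (actionGroupoid G M) → M) = fun φ => (φ.map 1).2 :=
    funext fun φ => (φ.map_snd 1).symm
  rw [h]
  exact continuous_snd.comp ((continuous_eval_const 1).comp Hom.continuous_map)

variable {x : M} (σ : K →ₜ* MulAction.stabilizer G x)

theorem sigmaBar_map (y : M) (hy : y ∈ MulAction.fixedPoints (imageSubgroup σ) M) (k : K) :
    (sigmaBar σ y hy).map k = ((σ k : G), y) := rfl

theorem exists_sigmaBar_eq_iff (φ : Hom K (actionGroupoid G M)) :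
    (∃ hy, sigmaBar σ φ.obj hy = φ) ↔ ∀ k, (φ.map k).1 = σ k := by
  constructor
  · rintro ⟨hy, h⟩ k
    rw [← h]; rfl
  · intro h
    have hy : φ.obj ∈ MulAction.fixedPoints (imageSubgroup σ) M :=
      (mem_fixedPoints_imageSubgroup_iff σ).2 fun k => by rw [← h k, φ.map_fst_smul_obj]
    exact ⟨hy, Hom.ext_map fun k => Prod.ext (h k).symm (φ.map_snd k).symm⟩

theorem smul_sigmaBar {h : G} (hh : h ∈ imageCentralizer σ) {y : M}
    (hy : y ∈ MulAction.fixedPoints (imageSubgroup σ) M)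
    (hhy : h • y ∈ MulAction.fixedPoints (imageSubgroup σ) M) :
    h • sigmaBar σ y hy = sigmaBar σ (h • y) hhy := by
  refine Hom.ext_map fun k => ?_
  rw [smul_map, sigmaBar_map, sigmaBar_map, ← (mem_imageCentralizer_iff σ).1 hh k,
    mul_inv_cancel_right]
  rfl

variable {A : Set M} (hA : ∀ y ∈ A, y ∈ MulAction.fixedPoints (imageSubgroup σ) M)

/-- The map `(g, y) ↦ g • σ̄(y)`, for `y` in a set of fixed points. -/
def sigmaOrbitMap (p : G × A) : Hom K (actionGroupoid G M) := p.1 • sigmaBar σ p.2 (hA _ p.2.2)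

theorem continuous_sigmaBar : Continuous fun y : A => sigmaBar σ (y : M) (hA _ y.2) := by
  refine continuous_induced_rng.2 (ContinuousMap.continuous_of_continuous_uncurry _ ?_)
  change Continuous fun q : A × K => ((σ q.2 : G), (q.1 : M))
  fun_prop

/-- Equality of the G-components, gσg⁻¹ = g'σg'⁻¹, says exactly that g⁻¹g' centralizes σ(K); the
base points then determine each other. -/
theorem sigmaOrbitMap_eq_iff (a b : G × A) :
    sigmaOrbitMap σ hA a = sigmaOrbitMap σ hA b ↔
      ∃ h ∈ imageCentralizer σ, b.1 = a.1 * h ∧ (b.2 : M) = h⁻¹ • (a.2 : M) := by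
  constructor
  · intro h
    have h1 : ∀ k, a.1 * (σ k : G) * a.1⁻¹ = b.1 * σ k * b.1⁻¹ ∧ a.1 • (a.2 : M) = b.1 • (b.2 : M) :=
      fun k => by
      have h2 : (sigmaOrbitMap σ hA a).map k = (sigmaOrbitMap σ hA b).map k := by rw [h]
      rw [sigmaOrbitMap, sigmaOrbitMap, smul_map, smul_map] at h2
      exact Prod.mk.inj h2
    refine ⟨a.1⁻¹ * b.1, (mem_imageCentralizer_iff σ).2 fun k => ?_, by simp, ?_⟩
    · have h3 := (h1 k).1
      rw [mul_inv_eq_iff_eq_mul] at h3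
      have h4 : (σ k : G) = a.1⁻¹ * (b.1 * σ k * b.1⁻¹) * a.1 := by
        rw [mul_assoc, ← h3, inv_mul_cancel_left]
      conv_lhs => rw [h4]
      group
    · rw [mul_inv_rev, inv_inv, mul_smul, (h1 1).2, inv_smul_smul]
  · rintro ⟨h, hh, h1, h2⟩
    have h3 : sigmaBar σ (b.2 : M) (hA _ b.2.2) = h⁻¹ • sigmaBar σ (a.2 : M) (hA _ a.2.2) := by
      have h4 : h⁻¹ • (a.2 : M) ∈ MulAction.fixedPoints (imageSubgroup σ) M := h2 ▸ hA _ b.2.2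
      rw [smul_sigmaBar σ (inv_mem hh) (hA _ a.2.2) h4]
      congr 1
    rw [sigmaOrbitMap, sigmaOrbitMap, h3, h1, mul_smul, smul_inv_smul]

variable [CompactSpace K] [T2Space K]

theorem continuous_eval_hom :
    Continuous fun p : K × Hom K (actionGroupoid G M) => p.2.map p.1 :=
  (Hom.continuous_map.comp continuous_snd).eval continuous_fst

instance : ContinuousSMul G (Hom K (actionGroupoid G M)) := by
  refine ⟨continuous_induced_rng.2 (ContinuousMap.continuous_of_continuous_uncurry _ ?_)⟩
  have h : (Function.uncurry fun (p : G × Hom K (actionGroupoid G M)) (k : K) =>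
      (p.1 • p.2).map k) = fun q => (q.1.1 * (q.1.2.map q.2).1 * q.1.1⁻¹, q.1.1 • q.1.2.obj) := by
    ext1 q
    exact smul_map _ _ _
  change Continuous (Function.uncurry fun (p : G × Hom K (actionGroupoid G M)) (k : K) =>
      (p.1 • p.2).map k)
  rw [h]
  have h1 : Continuous fun q : (G × Hom K (actionGroupoid G M)) × K => q.1.2.map q.2 :=
    continuous_eval_hom.comp (f := fun q : (G × Hom K (actionGroupoid G M)) × K => (q.2, q.1.2))
      (by fun_prop)
  have h2 : Continuous fun q : (G × Hom K (actionGroupoid G M)) × K => q.1.2.obj :=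
    continuous_obj.comp (by fun_prop)
  fun_prop

theorem continuous_sigmaOrbitMap : Continuous (sigmaOrbitMap σ hA) :=
  continuous_fst.smul ((continuous_sigmaBar σ hA).comp continuous_snd)

/-- A embeds through σ̄ as a closed set: ω is a continuous left inverse, and the image is cut out by
the closed conditions that the G-component is σ and ω lies in A. The action of the compact group G
is a closed map. General A is needed, for the saturation and for its complement in the fixed point
set. -/
theorem isClosedMap_sigmaOrbitMap [CompactSpace G] [T2Space G] (hAc : IsClosed A) :
    IsClosedMap (sigmaOrbitMap σ hA) := by
  have h1 : Topology.IsEmbedding fun y : A => sigmaBar σ (y : M) (hA _ y.2) :=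
    Topology.IsEmbedding.of_comp (continuous_sigmaBar σ hA) continuous_obj
      Topology.IsEmbedding.subtypeVal
  have h2 : range (fun y : A => sigmaBar σ (y : M) (hA _ y.2)) =
      {φ | ∀ k, (φ.map k).1 = (σ k : G)} ∩ Hom.obj ⁻¹' A := by
    ext φ
    constructor
    · rintro ⟨y, rfl⟩
      exact ⟨fun k => rfl, y.2⟩
    · rintro ⟨h, hφA⟩
      obtain ⟨hy, e⟩ := (exists_sigmaBar_eq_iff σ φ).2 h
      exact ⟨⟨φ.obj, hφA⟩, e⟩
  have h3 : IsClosed (range fun y : A => sigmaBar σ (y : M) (hA _ y.2)) := by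
    rw [h2]
    refine IsClosed.inter ?_ (hAc.preimage continuous_obj)
    simp only [ofPred_forall]
    refine isClosed_iInter fun k => isClosed_eq ?_ continuous_const
    exact continuous_fst.comp ((continuous_eval_const k).comp Hom.continuous_map)
  have h4 : Topology.IsClosedEmbedding
      (Prod.map id fun y : A => sigmaBar σ (y : M) (hA _ y.2) :
        G × A → G × Hom K (actionGroupoid G M)) := by
    refine ⟨Topology.IsEmbedding.id.prodMap h1, ?_⟩
    rw [range_prodMap]
    simpa using isClosed_univ.prod h3
  exact (isClosedMap_smul_of_compactSpace G _).comp h4.isClosedMap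

end HomSpace

/-! ### The component of σ̄(x) is the clopen image of the orbit map -/

section HomComponent

variable {K G M : Type*} [Group K] [TopologicalSpace K] [IsTopologicalGroup K] [CompactSpace K]
  [T2Space K] [Group G] [TopologicalSpace G] [IsTopologicalGroup G] [TopologicalSpace M]
  [MulAction G M] [ContinuousSMul G M] {x : M} (σ : K →ₜ* MulAction.stabilizer G x)

open TopGroupoid (Hom homComponent)

/-- By compactness of K, uniform closeness to σ is an open condition, and rigidity turns it into
conjugacy. Acting by g⁻¹ reduces a neighbourhood of a conjugate of σ to this case. -/
theorem isOpen_setOf_conj (dG : ℕ) [ChartedSpace (EuclideanSpace ℝ (Fin dG)) G]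
    [LieGroup (𝓡 dG) ∞ G] :
    IsOpen {φ : Hom K (actionGroupoid G M) | ∃ g : G, ∀ k, (φ.map k).1 = g * σ k * g⁻¹} := by
  let σ' : K →* G := (MulAction.stabilizer G x).subtype.comp σ.toMonoidHom
  have hσ' : Continuous σ' := continuous_subtype_val.comp σ.continuous_toFun
  obtain ⟨V, hV, hV1, hconj⟩ := exists_nhds_forall_conj dG hσ'
  have hV' : IsOpen {φ : Hom K (actionGroupoid G M) | ∀ k, (φ.map k).1 * (σ' k)⁻¹ ∈ V} :=
    isOpen_forall_mem_of_compactSpace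
      (f := fun p : K × Hom K (actionGroupoid G M) => (p.2.map p.1).1 * (σ' p.1)⁻¹)
      ((continuous_fst.comp continuous_eval_hom).mul (hσ'.comp continuous_fst).inv) hV
  rw [isOpen_iff_mem_nhds]
  rintro φ ⟨g, hg⟩
  have hφ : g⁻¹ • φ ∈ {φ : Hom K (actionGroupoid G M) | ∀ k, (φ.map k).1 * (σ' k)⁻¹ ∈ V} := by
    intro k
    have e : g⁻¹ * (φ.map k).1 * g⁻¹⁻¹ * (σ' k)⁻¹ = 1 := by
      rw [hg k]
      change g⁻¹ * (g * σ' k * g⁻¹) * g⁻¹⁻¹ * (σ' k)⁻¹ = 1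
      group
    rw [smul_map, e]
    exact hV1
  filter_upwards [(continuous_const_smul g⁻¹).continuousAt.preimage_mem_nhds (hV'.mem_nhds hφ)]
    with ψ hψ
  obtain ⟨g', hg'⟩ := hconj (g⁻¹ • ψ).groupHom
    (continuous_fst.comp (g⁻¹ • ψ).map.continuous) hψ
  refine ⟨g * g', fun k => ?_⟩
  have h : g⁻¹ * (ψ.map k).1 * g⁻¹⁻¹ = g' * σ' k * g'⁻¹ := hg' k
  have e : (ψ.map k).1 = g * (g⁻¹ * (ψ.map k).1 * g⁻¹⁻¹) * g⁻¹ := by group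
  rw [e, h]
  change g * (g' * σ' k * g'⁻¹) * g⁻¹ = g * g' * σ' k * (g * g')⁻¹
  group

omit [IsTopologicalGroup K] [CompactSpace K] [T2Space K]

omit [IsTopologicalGroup G] in
theorem mem_fixedPoints_of_mem_satFix {y : M} (hy : y ∈ satFix σ) :
    y ∈ MulAction.fixedPoints (imageSubgroup σ) M :=
  (mem_fixedPoints_imageSubgroup_iff σ).2 (smul_eq_of_mem_satFix σ hy)

/-- The map `(g, y) ↦ g • σ̄(y)` on `G × sat_H(fix)`. -/
abbrev satOrbitMap : G × satFix σ → Hom K (actionGroupoid G M) :=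
  sigmaOrbitMap σ fun _ => mem_fixedPoints_of_mem_satFix σ

theorem smul_mem_range_satOrbitMap (g : G) {φ : Hom K (actionGroupoid G M)}
    (hφ : φ ∈ range (satOrbitMap σ)) : g • φ ∈ range (satOrbitMap σ) := by
  obtain ⟨⟨g', y⟩, rfl⟩ := hφ
  exact ⟨(g * g', y), mul_smul g g' _⟩

theorem sigmaBarBase_mem_range_satOrbitMap : sigmaBarBase σ ∈ range (satOrbitMap σ) :=
  ⟨(1, ⟨x, mem_satFix_self σ⟩), one_smul G _⟩

/-- Saturating by the centralizer first adds nothing to the G-orbits, because h • σ̄(y) = σ̄(h • y).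
-/
theorem saturation_eq_range_satOrbitMap :
    saturation G {φ | ∃ (y : M) (hy : y ∈ MulAction.fixedPoints (imageSubgroup σ) M),
      y ∈ fixComponent (imageSubgroup σ) x ∧ φ = sigmaBar σ y hy} = range (satOrbitMap σ) := by
  ext φ
  simp only [saturation, mem_iUnion]
  constructor
  · rintro ⟨_, ⟨y, hy, hyx, rfl⟩, ⟨g, rfl⟩⟩
    have hyS : y ∈ satFix σ := by
      rw [mem_satFix_iff]
      refine ⟨1, one_mem _, ?_⟩
      rw [one_smul, ← fixedPoints_imageSubgroup]
      exact hyx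
    exact ⟨(g, ⟨y, hyS⟩), rfl⟩
  · rintro ⟨⟨g, y, hy⟩, rfl⟩
    obtain ⟨h, hh, hj⟩ := (mem_satFix_iff σ).1 hy
    have hj' := joinedIn_smul_imageCentralizer σ (inv_mem hh) hj
    rw [inv_smul_smul, ← fixedPoints_imageSubgroup] at hj'
    refine ⟨sigmaBar σ (h⁻¹ • y) hj'.target_mem, ⟨_, _, hj', rfl⟩, ⟨g * h, ?_⟩⟩
    change (g * h) • sigmaBar σ (h⁻¹ • y) hj'.target_mem = g • sigmaBar σ y _
    rw [← smul_sigmaBar σ (inv_mem hh) (mem_fixedPoints_of_mem_satFix σ hy), mul_smul,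
      smul_inv_smul]

/-- A path γ of fixed points starting at x yields the path t ↦ σ̄(γ(t)) of homomorphisms;
conjugation by arrows does the rest. -/
theorem range_satOrbitMap_subset_homComponent : range (satOrbitMap σ) ⊆ homSigmaBar σ := by
  rw [← saturation_eq_range_satOrbitMap]
  intro φ hφ
  simp only [saturation, mem_iUnion] at hφ
  obtain ⟨_, ⟨y, hy, hyx, rfl⟩, ⟨g, rfl⟩⟩ := hφ
  rintro T ⟨hT1, hT2, hT3⟩
  refine hT3 _ (hT2 _ hT1 ?_) (g, y) rfl
  obtain ⟨γ, hγ⟩ := hyx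
  exact ⟨{
    toFun := fun t => sigmaBar σ (γ t) (hγ t)
    continuous_toFun := (continuous_sigmaBar σ (A := MulAction.fixedPoints (imageSubgroup σ) M)
      fun _ h => h).comp (γ.continuous.subtype_mk hγ)
    source' := by congr 1; exact γ.source
    target' := by congr 1; exact γ.target }⟩

variable [IsTopologicalGroup K] [CompactSpace K] [T2Space K] [CompactSpace G] [T2Space G]
  [T2Space M] {d : ℕ} [ChartedSpace (EuclideanSpace ℝ (Fin d)) M]
  (hex : ∀ z : M, (∀ k, (σ k : G) • z = z) →
    Nonempty (EquivariantChart d (fun (k : K) (z : M) => (σ k : G) • z) z))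
  (dG : ℕ) [ChartedSpace (EuclideanSpace ℝ (Fin dG)) G] [LieGroup (𝓡 dG) ∞ G]

include hex dG

omit [IsTopologicalGroup K] [LieGroup (𝓡 dG) ∞ G] [ChartedSpace (EuclideanSpace ℝ (Fin dG)) G] in
omit dG in
theorem isClosedMap_satOrbitMap : IsClosedMap (satOrbitMap σ) :=
  isClosedMap_sigmaOrbitMap σ _ (isClosed_satFix σ hex)

/-- Closed because the orbit map is closed. Open because, within the open set of homomorphisms
conjugate to σ over G, its complement is the closed image coming from the fixed points outside the
saturation. -/
theorem isClopen_range_satOrbitMap : IsClopen (range (satOrbitMap σ)) := by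
  refine ⟨(isClosedMap_satOrbitMap σ hex).isClosed_range, ?_⟩
  have hA : ∀ y ∈ {z : M | ∀ k, (σ k : G) • z = z} \ satFix σ,
      y ∈ MulAction.fixedPoints (imageSubgroup σ) M := fun y hy =>
    (mem_fixedPoints_imageSubgroup_iff σ).2 hy.1
  have h1 : range (satOrbitMap σ) =
      {φ : Hom K (actionGroupoid G M) | ∃ g : G, ∀ k, (φ.map k).1 = g * σ k * g⁻¹} \
        range (sigmaOrbitMap σ hA) := by
    ext φ
    constructor
    · rintro ⟨⟨g, y⟩, rfl⟩
      refine ⟨⟨g, fun k => rfl⟩, ?_⟩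
      rintro ⟨⟨g', y'⟩, h⟩
      -- Both orbit maps restrict the one on all fixed points, whose fibres are H-orbits; so y'
      -- would be an H-translate of y.
      have h2 := (sigmaOrbitMap_eq_iff σ (A := {z : M | ∀ k, (σ k : G) • z = z})
        (fun y hy => (mem_fixedPoints_imageSubgroup_iff σ).2 hy)
        (g, ⟨y, smul_eq_of_mem_satFix σ y.2⟩) (g', ⟨y', y'.2.1⟩)).1 h.symm
      obtain ⟨h, hh, -, h3⟩ := h2
      refine y'.2.2 ?_
      change (y' : M) = h⁻¹ • (y : M) at h3
      rw [h3]
      exact smul_mem_satFix σ (inv_mem hh) y.2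
    · rintro ⟨⟨g, hg⟩, hφ⟩
      have h2 : ∀ k, ((g⁻¹ • φ).map k).1 = σ k := fun k => by
        rw [smul_map, hg]
        group
      obtain ⟨hy, h3⟩ := (exists_sigmaBar_eq_iff σ _).2 h2
      rw [eq_inv_smul_iff] at h3
      by_cases hyS : (g⁻¹ • φ).obj ∈ satFix σ
      · exact ⟨(g, ⟨_, hyS⟩), h3⟩
      · exact absurd ⟨(g, ⟨_, (mem_fixedPoints_imageSubgroup_iff σ).1 hy, hyS⟩), h3⟩ hφ
  rw [h1]
  exact (isOpen_setOf_conj σ dG).sdiff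
    (isClosedMap_sigmaOrbitMap σ hA (isClosed_fixed_diff_satFix σ hex)).isClosed_range

/-- A clopen set contains the path-component of each of its points, so the image is one of the sets
in the intersection defining the component. -/
theorem homSigmaBar_eq_range : homSigmaBar σ = range (satOrbitMap σ) := by
  refine Subset.antisymm (fun φ hφ => ?_) (range_satOrbitMap_subset_homComponent σ)
  refine hφ _ ⟨sigmaBarBase_mem_range_satOrbitMap σ, fun ψ hψ => ?_, ?_⟩
  · exact (pathComponent_subset_component ψ).trans
      ((isClopen_range_satOrbitMap σ hex dG).connectedComponent_subset hψ)
  · rintro ψ hψ ⟨g, y⟩ hg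
    obtain rfl : y = ψ.obj := hg
    exact smul_mem_range_satOrbitMap σ g hψ

theorem saturation_homSigmaBar : saturation G (homSigmaBar σ) = homSigmaBar σ := by
  rw [homSigmaBar_eq_range σ hex dG]
  ext φ
  simp only [saturation, mem_iUnion]
  constructor
  · rintro ⟨ψ, hψ, ⟨g, rfl⟩⟩
    exact smul_mem_range_satOrbitMap σ g hψ
  · exact fun h => ⟨φ, h, ⟨1, one_smul G φ⟩⟩

theorem sigmaSet_sigmaBarBase :
    TopGroupoid.sigmaSet (sigmaBarBase σ) = saturation G (fixComponent (imageSubgroup σ) x) := by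
  have h : homSigmaBar σ = _ := (homSigmaBar_eq_range σ hex dG).trans
    (saturation_eq_range_satOrbitMap σ).symm
  rw [TopGroupoid.sigmaSet]
  change Hom.obj '' homSigmaBar σ = _
  rw [h]
  ext y
  simp only [saturation, mem_iUnion, mem_image]
  constructor
  · rintro ⟨_, ⟨_, ⟨z, hz, hzx, rfl⟩, ⟨g, rfl⟩⟩, rfl⟩
    exact ⟨z, hzx, ⟨g, rfl⟩⟩
  · rintro ⟨z, hzx, ⟨g, rfl⟩⟩
    exact ⟨g • sigmaBar σ z (pathComponentIn_subset hzx), ⟨_, ⟨z, _, hzx, rfl⟩, ⟨g, rfl⟩⟩, rfl⟩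

/-- The balanced product `G ×_H sat_H(fix)` is homeomorphic to `hom(K, G ⋉ M; σ̄(x))`. -/
theorem exists_homeomorph_homSigmaBar :
    ∃ e : BalancedProduct (imageCentralizer σ) (satFix σ) ≃ₜ homSigmaBar σ,
      ∀ p, (e (BalancedProduct.mk (imageCentralizer σ) (satFix σ) p)).1 = satOrbitMap σ p := by
  have hr := homSigmaBar_eq_range σ hex dG
  let f : BalancedProduct (imageCentralizer σ) (satFix σ) → homSigmaBar σ :=
    Quotient.lift (fun p => ⟨satOrbitMap σ p, by rw [hr]; exact mem_range_self p⟩)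
      fun a b hab => Subtype.ext ((sigmaOrbitMap_eq_iff σ (fun _ => mem_fixedPoints_of_mem_satFix σ) a b).2 hab)
  have hf : ∀ p, (f (BalancedProduct.mk (imageCentralizer σ) (satFix σ) p)).1 =
    satOrbitMap σ p := fun p => rfl
  have hfc : Continuous f := continuous_coinduced_dom.2
    ((continuous_sigmaOrbitMap σ _).subtype_mk _)
  have hfi : Function.Injective f := by
    rintro ⟨a⟩ ⟨b⟩ hab
    exact Quotient.sound ((sigmaOrbitMap_eq_iff σ (fun _ => mem_fixedPoints_of_mem_satFix σ) a b).1 (congrArg Subtype.val hab))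
  have hfs : Function.Surjective f := by
    rintro ⟨φ, hφ⟩
    have h := hφ
    rw [hr] at h
    obtain ⟨p, rfl⟩ := h
    exact ⟨BalancedProduct.mk _ _ p, rfl⟩
  have hfcl : IsClosedMap f := fun C hC => by
    have h1 : f '' C = Subtype.val ⁻¹' (satOrbitMap σ '' (BalancedProduct.mk _ _ ⁻¹' C)) := by
      ext φ
      constructor
      · rintro ⟨⟨p⟩, hp, rfl⟩
        exact ⟨p, hp, rfl⟩
      · rintro ⟨p, hp, h⟩
        exact ⟨BalancedProduct.mk _ _ p, hp, Subtype.ext h⟩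
    rw [h1]
    exact (isClosedMap_satOrbitMap σ hex _ (hC.preimage continuous_coinduced_rng)).preimage
      continuous_subtype_val
  exact ⟨(Equiv.ofBijective f ⟨hfi, hfs⟩).toHomeomorphOfContinuousClosed hfc hfcl, hf⟩

end HomComponent

/-! ### Local product decomposition of a Lie group along a subgroup -/

/-- Near `1`, a Lie group is the product of a transversal to a subgroup `H` and of `H`, if `H` has a
slice chart at `1`. -/
theorem exists_local_factorization {K G : Type*} {d k c : ℕ} [TopologicalSpace K]
    [TopologicalSpace G] [Group G]
    [ChartedSpace (EuclideanSpace ℝ (Fin d)) G] [LieGroup (𝓡 d) ∞ G] {H : Subgroup G}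
    {act : K → G → G} (C : EquivariantChart d act (1 : G))
    (e : (EuclideanSpace ℝ (Fin k) × EuclideanSpace ℝ (Fin c)) ≃L[ℝ] EuclideanSpace ℝ (Fin d))
    (hH : ∀ z ∈ C.chart.source, z ∈ H ↔ (e.symm (C.chart z)).2 = 0) :
    ∃ (N : Set G) (δ : G → EuclideanSpace ℝ (Fin c)) (η : G → G)
      (D : EuclideanSpace ℝ (Fin c) → G) (B : Set (EuclideanSpace ℝ (Fin c))),
      IsOpen N ∧ 1 ∈ N ∧ ContMDiffOn (𝓡 d) (𝓡 c) ∞ δ N ∧ ContMDiffOn (𝓡 d) (𝓡 d) ∞ η N ∧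
      IsOpen B ∧ ContMDiffOn (𝓡 c) (𝓡 d) ∞ D B ∧ δ 1 ∈ B ∧ D (δ 1) = 1 ∧ η 1 = 1 ∧
      (∀ g ∈ N, η g ∈ H ∧ D (δ g) * η g = g) ∧
      (∀ w ∈ B, δ (D w) = w ∧ η (D w) = 1) ∧
      ∀ g ∈ N, ∀ h ∈ H, g * h ∈ N → δ (g * h) = δ g ∧ η (g * h) = η g * h := by
  have : IsTopologicalGroup G := topologicalGroup_of_lieGroup (𝓡 d) ∞
  let Φ := C.chart
  let a₁ : EuclideanSpace ℝ (Fin d) → EuclideanSpace ℝ (Fin d) := fun u => e (0, (e.symm u).2)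
  let a₂ : EuclideanSpace ℝ (Fin d) → EuclideanSpace ℝ (Fin d) := fun u => e ((e.symm u).1, 0)
  have ha₁ : ContDiff ℝ ∞ a₁ := by fun_prop
  have ha₂ : ContDiff ℝ ∞ a₂ := by fun_prop
  have ha₁0 : a₁ 0 = 0 := by simp [a₁]
  have ha₂0 : a₂ 0 = 0 := by simp [a₂]
  have hsum : ∀ u, a₁ u + a₂ u = u := fun u => by
    simp only [a₁, a₂]
    rw [← map_add, Prod.mk_add_mk, zero_add, add_zero, Prod.mk.eta, e.apply_symm_apply]
  -- the product map in coordinates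
  let f : EuclideanSpace ℝ (Fin d) × EuclideanSpace ℝ (Fin d) → EuclideanSpace ℝ (Fin d) :=
    fun p => Φ (Φ.symm p.1 * Φ.symm p.2)
  -- The coordinates of u transverse and tangent to H are exponentiated separately by the chart and
  -- multiplied. At 0 the derivative is a₁ + a₂ = id, so J is a local diffeomorphism.
  let J : EuclideanSpace ℝ (Fin d) → EuclideanSpace ℝ (Fin d) := fun u => f (a₁ u, a₂ u)
  let V₀ : Set (EuclideanSpace ℝ (Fin d)) := a₁ ⁻¹' Φ.target ∩ a₂ ⁻¹' Φ.target
  have hV₀ : IsOpen V₀ := (Φ.open_target.preimage ha₁.continuous).inter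
    (Φ.open_target.preimage ha₂.continuous)
  have hprod : ContinuousOn (fun u => Φ.symm (a₁ u) * Φ.symm (a₂ u)) V₀ :=
    (Φ.symm.continuousOn.comp ha₁.continuous.continuousOn fun u hu => hu.1).mul
      (Φ.symm.continuousOn.comp ha₂.continuous.continuousOn fun u hu => hu.2)
  let V := V₀ ∩ (fun u => Φ.symm (a₁ u) * Φ.symm (a₂ u)) ⁻¹' Φ.source
  have hV : IsOpen V := hprod.isOpen_inter_preimage hV₀ Φ.open_source
  have h0V : 0 ∈ V := by
    refine ⟨⟨?_, ?_⟩, ?_⟩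
    · rw [mem_preimage, ha₁0]; exact C.zero_mem_target
    · rw [mem_preimage, ha₂0]; exact C.zero_mem_target
    · rw [mem_preimage, ha₁0, ha₂0, C.symm_zero, mul_one]; exact C.mem_source
  have hJ : ContDiffOn ℝ ∞ J V := fun u hu => by
    have h1 : ContDiffAt ℝ ∞ f (a₁ u, a₂ u) :=
      C.contDiffAt_comp₂ (b := fun p => p.1 * p.2) (contMDiff_fst.mul contMDiff_snd)
        hu.1.1 hu.1.2 hu.2
    exact (h1.comp u (ha₁.contDiffAt.prodMk ha₂.contDiffAt)).contDiffWithinAt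
  have hJ0 : J 0 = 0 := by simp only [J, f, ha₁0, ha₂0, Φ, C.symm_zero, mul_one, C.map_eq_zero]
  have hJd : HasFDerivAt J (ContinuousLinearMap.id ℝ _) 0 := by
    have h1 : HasFDerivAt f (ContinuousLinearMap.fst ℝ _ _ + ContinuousLinearMap.snd ℝ _ _)
        (a₁ 0, a₂ 0) := by
      rw [ha₁0, ha₂0]; exact C.hasStrictFDerivAt_mul.hasFDerivAt
    have h2 := (ha₁.differentiable (by simp) 0).hasFDerivAt
    have h3 := (ha₂.differentiable (by simp) 0).hasFDerivAt
    have h4 := HasFDerivAt.comp (0 : EuclideanSpace ℝ (Fin d)) (g := f) h1 (h2.prodMk h3)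
    have h5 : HasFDerivAt (fun u => a₁ u + a₂ u) (ContinuousLinearMap.id ℝ _) 0 := by
      simp only [hsum]; exact hasFDerivAt_id 0
    have h6 := (h2.add h3).unique h5
    rw [← h6]
    exact h4
  obtain ⟨j, h0j, hjV, hjJ, hj⟩ := exists_openPartialHomeomorph_of_hasFDerivAt_id hV hJ h0V hJd
  have hj0 : j 0 = 0 := by rw [hjJ, hJ0]
  have hj0' : j.symm 0 = 0 := by
    have := j.left_inv h0j
    rwa [hj0] at this
  let N₁ : Set G := Φ.source ∩ Φ ⁻¹' j.target
  have hN₁ : IsOpen N₁ := Φ.isOpen_inter_preimage j.open_target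
  have h1N₁ : (1 : G) ∈ N₁ := ⟨C.mem_source, by
    rw [mem_preimage, C.map_eq_zero, ← hj0]; exact j.map_source h0j⟩
  let υ : G → EuclideanSpace ℝ (Fin d) := fun g => j.symm (Φ g)
  have hυ1 : υ 1 = 0 := by
    change j.symm (C.chart 1) = 0
    rw [C.map_eq_zero, hj0']
  have hυ : ContMDiffOn (𝓡 d) (𝓡 d) ∞ υ N₁ :=
    (contMDiffOn_iff_contDiffOn.2 hj).comp (C.contMDiffOn.mono fun g hg => hg.1) fun g hg => hg.2
  have hυj : ∀ g ∈ N₁, υ g ∈ j.source := fun g hg => j.map_target hg.2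
  have hυV : ∀ g ∈ N₁, υ g ∈ V := fun g hg => hjV (hυj g hg)
  let δ : G → EuclideanSpace ℝ (Fin c) := fun g => (e.symm (υ g)).2
  let η : G → G := fun g => Φ.symm (a₂ (υ g))
  let D : EuclideanSpace ℝ (Fin c) → G := fun w => Φ.symm (e (0, w))
  have hδ1 : δ 1 = 0 := by simp [δ, hυ1]
  have hη1 : η 1 = 1 := by simp only [η, hυ1, ha₂0]; exact C.symm_zero
  have hη : ContMDiffOn (𝓡 d) (𝓡 d) ∞ η N₁ := by
    refine C.contMDiffOn_symm.comp (f := fun g => a₂ (υ g)) ?_ fun g hg => (hυV g hg).1.2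
    exact ha₂.contMDiff.comp_contMDiffOn hυ
  have hδ : ContMDiffOn (𝓡 d) (𝓡 c) ∞ δ N₁ := by
    have h1 : ContDiff ℝ ∞ fun u => (e.symm u).2 := by fun_prop
    exact h1.contMDiff.comp_contMDiffOn hυ
  have hDη : ∀ g ∈ N₁, D (δ g) * η g = g := fun g hg => by
    refine Φ.injOn (hυV g hg).2 hg.1 ?_
    change J (υ g) = Φ g
    rw [← hjJ]
    exact j.right_inv hg.2
  have hηsrc : ∀ g ∈ N₁, η g ∈ Φ.source := fun g hg => Φ.map_target (hυV g hg).1.2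
  have hηH : ∀ g ∈ N₁, η g ∈ H := fun g hg => by
    rw [hH _ (hηsrc g hg)]
    change (e.symm (Φ (Φ.symm (a₂ (υ g))))).2 = 0
    rw [Φ.right_inv (hυV g hg).1.2]
    simp [a₂]
  -- uniqueness of the factorization
  have huniq : ∀ g ∈ N₁, ∀ h ∈ H, η g * h ∈ Φ.source →
      e ((e.symm (Φ (η g * h))).1, δ g) ∈ j.source → δ (g * h) = δ g ∧ η (g * h) = η g * h := by
    intro g hg h hh hsrc hjs
    have h1 : e ((e.symm (Φ (η g * h))).1, 0) = Φ (η g * h) := by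
      rw [← (hH _ hsrc).1 (mul_mem (hηH g hg) hh), Prod.mk.eta, e.apply_symm_apply]
    -- The product g h = D(δ g) · (η g · h) is already factored, with second factor in H, and J is
    -- injective on `j.source`.
    have h2 : υ (g * h) = e ((e.symm (Φ (η g * h))).1, δ g) := by
      rw [← j.left_inv hjs, hjJ]
      change j.symm (Φ (g * h)) = j.symm (Φ (Φ.symm (a₁ _) * Φ.symm (a₂ _)))
      simp only [a₁, a₂, e.symm_apply_apply]
      rw [h1, Φ.left_inv hsrc, ← mul_assoc]
      conv_lhs => rw [← hDη g hg]
    constructor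
    · change (e.symm (υ (g * h))).2 = _
      rw [h2, e.symm_apply_apply]
    · change Φ.symm (a₂ (υ (g * h))) = _
      rw [h2]
      simp only [a₂, e.symm_apply_apply]
      rw [h1, Φ.left_inv hsrc]
  -- At (1, 1) the two expressions are 1 and 0, so continuity gives the neighbourhood. With g' = g
  -- h, the first expression is η g · h, so uniqueness applies although h itself is not assumed
  -- close to 1.
  obtain ⟨N₂, hN₂, h1N₂, hN₂u⟩ : ∃ N₂ : Set G, IsOpen N₂ ∧ 1 ∈ N₂ ∧ ∀ g ∈ N₂, ∀ g' ∈ N₂,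
      η g * (g⁻¹ * g') ∈ Φ.source ∧
        e ((e.symm (Φ (η g * (g⁻¹ * g')))).1, δ g) ∈ j.source := by
    have hη1c : ContinuousAt η 1 := hη.continuousOn.continuousAt (hN₁.mem_nhds h1N₁)
    have hδ1c : ContinuousAt δ 1 := hδ.continuousOn.continuousAt (hN₁.mem_nhds h1N₁)
    have hΦ1c : ContinuousAt Φ 1 := Φ.continuousAt C.mem_source
    have hΦ1 : Φ 1 = 0 := C.map_eq_zero
    have hΦ1s : Φ.source ∈ 𝓝 1 := Φ.open_source.mem_nhds C.mem_source
    have hj0s : j.source ∈ 𝓝 0 := j.open_source.mem_nhds h0j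
    clear_value η δ Φ
    have c1 : Filter.Tendsto (fun p : G × G => η p.1 * (p.1⁻¹ * p.2)) (𝓝 (1, 1)) (𝓝 1) := by
      have h1 : Filter.Tendsto η (𝓝 1) (𝓝 1) := by
        have := hη1c.tendsto
        rwa [hη1] at this
      have h2 : Filter.Tendsto (fun p : G × G => p.1⁻¹ * p.2) (𝓝 (1, 1)) (𝓝 1) :=
        Continuous.tendsto' (by fun_prop) _ _ (by simp)
      have h3 := (h1.comp (continuous_fst.tendsto ((1 : G), (1 : G)))).mul h2
      rwa [mul_one] at h3
    have c2 : Filter.Tendsto (fun p : G × G => e ((e.symm (Φ (η p.1 * (p.1⁻¹ * p.2)))).1, δ p.1))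
        (𝓝 (1, 1)) (𝓝 0) := by
      have d1 : Filter.Tendsto (fun p : G × G => δ p.1) (𝓝 (1, 1)) (𝓝 0) := by
        have := hδ1c.tendsto
        rw [hδ1] at this
        exact this.comp (continuous_fst.tendsto ((1 : G), (1 : G)))
      have d2 : Filter.Tendsto Φ (𝓝 1) (𝓝 0) := by
        have := hΦ1c.tendsto
        rwa [hΦ1] at this
      have d3 : Filter.Tendsto (fun u => (e.symm u).1) (𝓝 0) (𝓝 0) :=
        Continuous.tendsto' (by fun_prop) _ _ (by simp)
      have d4 : Filter.Tendsto e (𝓝 (0, 0)) (𝓝 0) := Continuous.tendsto' e.continuous _ _ (by simp)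
      exact d4.comp (((d3.comp (d2.comp c1))).prodMk_nhds d1)
    have h3 := (c1.eventually_mem hΦ1s).and (c2.eventually_mem hj0s)
    rw [nhds_prod_eq] at h3
    obtain ⟨U, hU, hU'⟩ := (Filter.mem_prod_self_iff).1 h3
    obtain ⟨U', hU'U, hU'o, h1U'⟩ := mem_nhds_iff.1 hU
    exact ⟨U', hU'o, h1U', fun g hg g' hg' => hU' (mk_mem_prod (hU'U hg) (hU'U hg'))⟩
  let B : Set (EuclideanSpace ℝ (Fin c)) := (fun w => e (0, w)) ⁻¹' (j.source ∩ Φ.target)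
  have hB : IsOpen B := (j.open_source.inter Φ.open_target).preimage (by fun_prop)
  refine ⟨N₁ ∩ N₂, δ, η, D, B, hN₁.inter hN₂, ⟨h1N₁, h1N₂⟩, hδ.mono inter_subset_left,
    hη.mono inter_subset_left, hB, ?_, ?_, ?_, hη1, fun g hg => ⟨hηH g hg.1, hDη g hg.1⟩, ?_, ?_⟩
  · refine C.contMDiffOn_symm.comp (f := fun w => e (0, w)) ?_ fun w hw => hw.2
    have h1 : ContDiff ℝ ∞ fun w : EuclideanSpace ℝ (Fin c) => e (0, w) := by fun_prop
    exact h1.contMDiff.contMDiffOn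
  · rw [hδ1, mem_preimage, Prod.mk_zero_zero, map_zero]
    exact ⟨h0j, C.zero_mem_target⟩
  · simp only [D, hδ1, Prod.mk_zero_zero, map_zero]
    exact C.symm_zero
  · intro w hw
    have h1 : υ (D w) = e (0, w) := by
      have hw1 : e (0, w) ∈ j.source := hw.1
      rw [← j.left_inv hw1, hjJ]
      change j.symm (Φ (Φ.symm (e (0, w)))) = j.symm (Φ (Φ.symm (a₁ _) * Φ.symm (a₂ _)))
      simp only [a₁, a₂, e.symm_apply_apply, Prod.mk_zero_zero, map_zero]
      rw [show Φ.symm 0 = 1 from C.symm_zero, mul_one]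
    constructor
    · simp only [δ, h1, e.symm_apply_apply]
    · simp only [η, h1, a₂, e.symm_apply_apply, Prod.mk_zero_zero, map_zero]
      exact C.symm_zero
  · intro g hg h hh hgh
    have h1 := hN₂u g hg.2 (g * h) hgh.2
    rw [inv_mul_cancel_left] at h1
    exact huniq g hg.1 h hh h1.1 h1.2

/-! ### The balanced product as a manifold -/

section BalancedProductManifold

variable {G M : Type*} {dG d k c c' n : ℕ} [TopologicalSpace G] [Group G]
  [ChartedSpace (EuclideanSpace ℝ (Fin dG)) G] [LieGroup (𝓡 dG) ∞ G]
  [TopologicalSpace M] [ChartedSpace (EuclideanSpace ℝ (Fin d)) M] [MulAction G M]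
  [ContMDiffSMul (𝓡 dG) (𝓡 d) ∞ G M]

/-- The embedding gives continuity into S and the immersion gives smoothness, so smoothness into S
can be tested in M. -/
theorem contMDiffOn_of_isImmersion_subtypeVal {E' A X : Type*} [NormedAddCommGroup E']
    [NormedSpace ℝ E'] [TopologicalSpace A] {I : ModelWithCorners ℝ E' A} [TopologicalSpace X]
    [ChartedSpace A X] {S : Set M} [ChartedSpace (EuclideanSpace ℝ (Fin k)) S]
    [IsManifold (𝓡 d) ∞ M] [IsManifold (𝓡 k) ∞ S]
    (hS : Manifold.IsSmoothEmbedding (𝓡 k) (𝓡 d) ∞ (Subtype.val : S → M)) {f : X → S} {U : Set X}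
    (hU : IsOpen U) (hf : ContMDiffOn I (𝓡 d) ∞ (fun x => (f x : M)) U) :
    ContMDiffOn I (𝓡 k) ∞ f U := fun x hx =>
  have h1 := hf.contMDiffAt (hU.mem_nhds hx)
  ((ContMDiffAt.iff_comp_isImmersionAt (hS.isImmersion.isImmersionAt (f x))).2
    ⟨Topology.IsEmbedding.subtypeVal.continuousAt_iff.2 h1.continuousAt, h1⟩).contMDiffWithinAt

omit [LieGroup (𝓡 dG) ∞ G] in
/-- Near `(1, y₀)`, the orbits of the action of `H` on `G × S` are the fibres of a smooth map with a
smooth section, if there are slice charts for `H` at `1` and for `S` at `y₀`. -/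
theorem exists_local_quotient_at_one [IsManifold (𝓡 d) ∞ M] {H : Subgroup G} {S : Set M}
    (hHS : ∀ h ∈ H, ∀ y ∈ S, h • y ∈ S)
    [ChartedSpace (EuclideanSpace ℝ (Fin k)) S] [IsManifold (𝓡 k) ∞ S]
    (hval : Manifold.IsSmoothEmbedding (𝓡 k) (𝓡 d) ∞ (Subtype.val : S → M))
    {N₀ : Set G} {δ : G → EuclideanSpace ℝ (Fin c)} {η : G → G}
    {D : EuclideanSpace ℝ (Fin c) → G} {B₀ : Set (EuclideanSpace ℝ (Fin c))}
    (hN₀ : IsOpen N₀) (h1N₀ : 1 ∈ N₀) (hδ : ContMDiffOn (𝓡 dG) (𝓡 c) ∞ δ N₀)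
    (hη : ContMDiffOn (𝓡 dG) (𝓡 dG) ∞ η N₀) (hB₀ : IsOpen B₀)
    (hD : ContMDiffOn (𝓡 c) (𝓡 dG) ∞ D B₀) (hδ1 : δ 1 ∈ B₀) (hDδ1 : D (δ 1) = 1) (hη1 : η 1 = 1)
    (hDη : ∀ g ∈ N₀, η g ∈ H ∧ D (δ g) * η g = g) (hδD : ∀ w ∈ B₀, δ (D w) = w ∧ η (D w) = 1)
    (hmul : ∀ g ∈ N₀, ∀ h ∈ H, g * h ∈ N₀ → δ (g * h) = δ g ∧ η (g * h) = η g * h)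
    {Φ : OpenPartialHomeomorph M (EuclideanSpace ℝ (Fin d))}
    {e : (EuclideanSpace ℝ (Fin k) × EuclideanSpace ℝ (Fin c')) ≃L[ℝ] EuclideanSpace ℝ (Fin d)}
    (hΦ : ContMDiffOn (𝓡 d) (𝓡 d) ∞ Φ Φ.source) (hΦ' : ContMDiffOn (𝓡 d) (𝓡 d) ∞ Φ.symm Φ.target)
    (hS : ∀ z ∈ Φ.source, z ∈ S ↔ (e.symm (Φ z)).2 = 0) {y₀ : S} (hy₀ : (y₀ : M) ∈ Φ.source)
    (L : (EuclideanSpace ℝ (Fin c) × EuclideanSpace ℝ (Fin k)) ≃L[ℝ] EuclideanSpace ℝ (Fin n)) :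
    ∃ (N : Set (G × S)) (r : G × S → EuclideanSpace ℝ (Fin n))
      (s : EuclideanSpace ℝ (Fin n) → G × S) (B : Set (EuclideanSpace ℝ (Fin n))), IsOpen N ∧
      (1, y₀) ∈ N ∧ ContMDiffOn ((𝓡 dG).prod (𝓡 k)) (𝓡 n) ∞ r N ∧ IsOpen B ∧ r (1, y₀) ∈ B ∧
      s (r (1, y₀)) = (1, y₀) ∧ ContMDiffOn (𝓡 n) ((𝓡 dG).prod (𝓡 k)) ∞ s B ∧
      (∀ v ∈ B, r (s v) = v) ∧
      ∀ a ∈ N, ∀ b ∈ N, (∃ h ∈ H, b.1 = a.1 * h ∧ (b.2 : M) = h⁻¹ • (a.2 : M)) ↔ r a = r b := by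
  let F := sliceChart Φ e hS y₀
  -- Moving the H-factor of g onto y replaces (g, y) by the equivalent pair (D(δ g), η g • y); the
  -- coordinates of this normal form are the local invariants of the orbit.
  let ζ : G × S → M := fun p => η p.1 • (p.2 : M)
  have hopen : IsOpen (N₀ ×ˢ (univ : Set S)) := hN₀.prod isOpen_univ
  have hζ : ContMDiffOn ((𝓡 dG).prod (𝓡 k)) (𝓡 d) ∞ ζ (N₀ ×ˢ univ) := by
    have h1 : ContMDiffOn ((𝓡 dG).prod (𝓡 k)) (𝓡 dG) ∞ (fun p : G × S => η p.1) (N₀ ×ˢ univ) :=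
      hη.comp contMDiffOn_fst fun p hp => hp.1
    have h2 : ContMDiffOn ((𝓡 dG).prod (𝓡 k)) (𝓡 d) ∞ (fun p : G × S => (p.2 : M)) (N₀ ×ˢ univ) :=
      (hval.isImmersion.contMDiff.comp contMDiff_snd).contMDiffOn
    exact h1.smul h2
  have hζS : ∀ p ∈ N₀ ×ˢ (univ : Set S), ζ p ∈ S := fun p hp => hHS _ (hDη _ hp.1).1 _ p.2.2
  let N := (N₀ ×ˢ univ) ∩ ζ ⁻¹' Φ.source
  let r : G × S → EuclideanSpace ℝ (Fin n) := fun p => L (δ p.1, (e.symm (Φ (ζ p))).1)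
  let s : EuclideanSpace ℝ (Fin n) → G × S := fun v => (D (L.symm v).1, F.symm (L.symm v).2)
  let B : Set (EuclideanSpace ℝ (Fin n)) := L.symm ⁻¹' (B₀ ×ˢ F.target)
  have hr1 : r (1, y₀) = L (δ 1, F y₀) := by simp only [r, ζ, hη1, one_smul]; rfl
  refine ⟨N, r, s, B, hζ.continuousOn.isOpen_inter_preimage hopen Φ.open_source, ?_, ?_,
    (hB₀.prod F.open_target).preimage L.symm.continuous, ?_, ?_, ?_, ?_, ?_⟩
  · refine ⟨⟨h1N₀, mem_univ _⟩, ?_⟩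
    simpa only [mem_preimage, ζ, hη1, one_smul] using hy₀
  · have h1 : ContMDiffOn ((𝓡 dG).prod (𝓡 k)) (𝓡 d) ∞ (fun p => Φ (ζ p)) N :=
      hΦ.comp (hζ.mono inter_subset_left) fun p hp => hp.2
    have h2 : ContMDiffOn ((𝓡 dG).prod (𝓡 k)) (𝓡 k) ∞ (fun p => (e.symm (Φ (ζ p))).1) N :=
      (contDiff_fst.comp e.symm.contDiff).contMDiff.comp_contMDiffOn h1
    have h3 : ContMDiffOn ((𝓡 dG).prod (𝓡 k)) (𝓡 c) ∞ (fun p : G × S => δ p.1) N :=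
      hδ.comp contMDiffOn_fst fun p hp => hp.1.1
    exact L.contDiff.contMDiff.comp_contMDiffOn (h3.prodMk_space h2)
  · rw [hr1]
    change L.symm (L (δ 1, F y₀)) ∈ B₀ ×ˢ F.target
    rw [L.symm_apply_apply]
    exact ⟨hδ1, F.map_source hy₀⟩
  · rw [hr1]
    simp only [s, L.symm_apply_apply, hDδ1]
    rw [F.left_inv hy₀]
  · have h1 : ContMDiffOn (𝓡 n) (𝓡 dG) ∞ (fun v => D (L.symm v).1) B :=
      hD.comp ((contDiff_fst.comp L.symm.contDiff).contMDiff.contMDiffOn) fun v hv => hv.1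
    have h2 : ContMDiffOn (𝓡 n) (𝓡 k) ∞ (fun v => F.symm (L.symm v).2) B := by
      refine contMDiffOn_of_isImmersion_subtypeVal hval
        ((hB₀.prod F.open_target).preimage L.symm.continuous) ?_
      have h3 : ContDiff ℝ ∞ fun v => e ((L.symm v).2, 0) := by fun_prop
      exact (hΦ'.comp h3.contMDiff.contMDiffOn fun v hv => hv.2).congr fun v hv =>
        coe_sliceChart_symm hS y₀ hv.2
    exact h1.prodMk h2
  · intro v hv
    simp only [r, s, ζ, (hδD _ hv.1).1, (hδD _ hv.1).2, one_smul]
    have h2 : (e.symm (Φ ((F.symm (L.symm v).2 : S) : M))).1 = (L.symm v).2 := F.right_inv hv.2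
    rw [h2, Prod.mk.eta, L.apply_symm_apply]
  · intro a ha b hb
    constructor
    · rintro ⟨h, hh, h1, h2⟩
      have h3 := hmul a.1 ha.1.1 h hh (h1 ▸ hb.1.1)
      simp only [r, ζ, h1, h2, h3.1, h3.2, mul_smul, smul_inv_smul]
    · intro hab
      have h1 := Prod.mk.inj (L.injective hab)
      have h2 : (⟨ζ a, hζS a ha.1⟩ : S) = ⟨ζ b, hζS b hb.1⟩ := F.injOn ha.2 hb.2 h1.2
      have h3 : η a.1 • (a.2 : M) = η b.1 • (b.2 : M) := congrArg Subtype.val h2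
      refine ⟨(η a.1)⁻¹ * η b.1, mul_mem (inv_mem (hDη _ ha.1.1).1) (hDη _ hb.1.1).1, ?_, ?_⟩
      · conv_lhs => rw [← (hDη _ hb.1.1).2, ← h1.1]
        conv_rhs => rw [← mul_assoc]; arg 1; arg 1; rw [← (hDη _ ha.1.1).2]
        rw [mul_inv_cancel_right]
      · rw [mul_inv_rev, inv_inv, mul_smul, h3, inv_smul_smul]

/-- The balanced product `G ×_H S` of a Lie group and an embedded submanifold `S`, given by its
quotient map `q`, is a manifold, if the subgroup `H` has a slice chart at `1`. -/
theorem exists_isSmoothSubmersion_of_balancedProduct [IsManifold (𝓡 d) ∞ M] {H : Subgroup G}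
    {S : Set M} (hHS : ∀ h ∈ H, ∀ y ∈ S, h • y ∈ S)
    [ChartedSpace (EuclideanSpace ℝ (Fin k)) S] [IsManifold (𝓡 k) ∞ S]
    (hval : Manifold.IsSmoothEmbedding (𝓡 k) (𝓡 d) ∞ (Subtype.val : S → M))
    (hslice : ∀ y : S, ∃ (Φ : OpenPartialHomeomorph M (EuclideanSpace ℝ (Fin d)))
      (e : (EuclideanSpace ℝ (Fin k) × EuclideanSpace ℝ (Fin c')) ≃L[ℝ] EuclideanSpace ℝ (Fin d)),
      (y : M) ∈ Φ.source ∧ ContMDiffOn (𝓡 d) (𝓡 d) ∞ Φ Φ.source ∧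
      ContMDiffOn (𝓡 d) (𝓡 d) ∞ Φ.symm Φ.target ∧
      ∀ z ∈ Φ.source, z ∈ S ↔ (e.symm (Φ z)).2 = 0)
    {K : Type*} [TopologicalSpace K] {act : K → G → G} (C : EquivariantChart dG act (1 : G))
    (eG : (EuclideanSpace ℝ (Fin n) × EuclideanSpace ℝ (Fin c)) ≃L[ℝ] EuclideanSpace ℝ (Fin dG))
    (hH : ∀ z ∈ C.chart.source, z ∈ H ↔ (eG.symm (C.chart z)).2 = 0)
    {Y : Type*} [TopologicalSpace Y] {q : G × S → Y} (hq : Continuous q)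
    (hqs : Function.Surjective q) (hqo : IsOpenMap q)
    (hqr : ∀ a b, q a = q b ↔ ∃ h ∈ H, b.1 = a.1 * h ∧ (b.2 : M) = h⁻¹ • (a.2 : M)) :
    ∃ _ : ChartedSpace (EuclideanSpace ℝ (Fin (c + k))) Y, IsManifold (𝓡 (c + k)) ∞ Y ∧
      IsSmoothSubmersion ((𝓡 dG).prod (𝓡 k)) (𝓡 (c + k)) q := by
  refine exists_isSmoothSubmersion_of_isOpenMap hq hqo hqs ?_ ?_
  · intro a b hab
    obtain ⟨h, hh, h1, h2⟩ := (hqr a b).1 hab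
    refine ⟨fun p => (p.1 * h, ⟨h⁻¹ • (p.2 : M), hHS _ (inv_mem hh) _ p.2.2⟩), ?_, fun p => ?_,
      Prod.ext h1.symm (Subtype.ext h2.symm)⟩
    · have h5 : ContMDiff ((𝓡 dG).prod (𝓡 k)) (𝓡 dG) ∞ fun _ : G × S => h⁻¹ := contMDiff_const
      have h3 : ContMDiff ((𝓡 dG).prod (𝓡 k)) (𝓡 d) ∞ fun p : G × S => h⁻¹ • (p.2 : M) :=
        h5.smul (hval.isImmersion.contMDiff.comp contMDiff_snd)
      have h4 : ContMDiff ((𝓡 dG).prod (𝓡 k)) (𝓡 dG) ∞ fun p : G × S => p.1 * h :=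
        contMDiff_fst.mul contMDiff_const
      refine h4.prodMk ?_
      rw [← contMDiffOn_univ] at h3 ⊢
      exact contMDiffOn_of_isImmersion_subtypeVal hval isOpen_univ h3
    · exact ((hqr _ _).2 ⟨h, hh, rfl, rfl⟩).symm
  · rintro ⟨g₀, y₀⟩
    obtain ⟨N₀, δ, η, D, B₀, hN₀, h1N₀, hδ, hη, hB₀, hD, hδ1, hDδ1, hη1, hDη, hδD, hmul⟩ :=
      exists_local_factorization C eG hH
    obtain ⟨Φ, e, hy₀, hΦ, hΦ', hS⟩ := hslice y₀
    let L : (EuclideanSpace ℝ (Fin c) × EuclideanSpace ℝ (Fin k)) ≃L[ℝ]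
      EuclideanSpace ℝ (Fin (c + k)) := ContinuousLinearEquiv.ofFinrankEq (by simp)
    obtain ⟨N, r, s, B, hN, h1N, hr, hB, hr1, hsr, hs, hrs, hqr'⟩ := exists_local_quotient_at_one
      hHS hval hN₀ h1N₀ hδ hη hB₀ hD hδ1 hDδ1 hη1 hDη hδD hmul hΦ hΦ' hS hy₀ L
    -- Left translation commutes with the right action of H, so it carries the local quotient at (1,
    -- y₀) to (g₀, y₀).
    let l : G → G × S → G × S := fun g p => (g * p.1, p.2)
    have hl : ∀ g, ContMDiff ((𝓡 dG).prod (𝓡 k)) ((𝓡 dG).prod (𝓡 k)) ∞ (l g) := fun g => by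
      have h1 : ContMDiff ((𝓡 dG).prod (𝓡 k)) (𝓡 dG) ∞ fun p : G × S => g * p.1 :=
        contMDiff_const.mul contMDiff_fst
      exact h1.prodMk contMDiff_snd
    have hl1 : l g₀⁻¹ (g₀, y₀) = (1, y₀) := by simp [l]
    refine ⟨l g₀⁻¹ ⁻¹' N, r ∘ l g₀⁻¹, l g₀ ∘ s, B, hN.preimage (hl _).continuous, ?_,
      hr.comp (hl _).contMDiffOn fun p hp => hp, hB, ?_, ?_, (hl _).comp_contMDiffOn hs,
      fun v hv => ?_, fun a ha b hb => ?_⟩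
    · rwa [mem_preimage, hl1]
    · rwa [Function.comp_apply, hl1]
    · rw [Function.comp_apply, Function.comp_apply, hl1, hsr]
      simp [l]
    · have h1 : l g₀⁻¹ (l g₀ (s v)) = s v := by simp [l]
      rw [Function.comp_apply, Function.comp_apply, h1, hrs v hv]
    · rw [hqr, Function.comp_apply, Function.comp_apply, ← hqr' _ ha _ hb]
      simp only [l, mul_assoc, mul_right_inj]

end BalancedProductManifold

/-- As for any quotient by a group of homeomorphisms, the saturation of an open set is a union of
open translates. -/
theorem BalancedProduct.isOpenMap_mk {G M : Type*} [Group G] [TopologicalSpace G]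
    [IsTopologicalGroup G] [TopologicalSpace M] [MulAction G M] [ContinuousSMul G M]
    {H : Subgroup G} {S : Set M} (hHS : ∀ h ∈ H, ∀ y ∈ S, h • y ∈ S) :
    IsOpenMap (BalancedProduct.mk H S) := by
  intro O hO
  let τ : H → G × S → G × S :=
    fun h p => (p.1 * h, ⟨(h : G)⁻¹ • (p.2 : M), hHS _ (inv_mem h.2) _ p.2.2⟩)
  have hτ : ∀ h, Continuous (τ h) := fun h => by fun_prop
  have h1 : BalancedProduct.mk H S ⁻¹' (BalancedProduct.mk H S '' O) = ⋃ h, τ h ⁻¹' O := by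
    ext p
    simp only [mem_preimage, mem_iUnion]
    constructor
    · rintro ⟨p', hp', h⟩
      obtain ⟨h, hh, h1, h2⟩ := Quotient.exact h.symm
      refine ⟨⟨h, hh⟩, ?_⟩
      have h3 : τ ⟨h, hh⟩ p = p' := Prod.ext h1.symm (Subtype.ext h2.symm)
      rwa [h3]
    · rintro ⟨h, hp⟩
      exact ⟨τ h p, hp, (Quotient.sound ⟨h, h.2, rfl, rfl⟩ :
        BalancedProduct.mk H S p = BalancedProduct.mk H S (τ h p)).symm⟩
  refine isOpen_coinduced.2 ?_
  rw [h1]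
  exact isOpen_iUnion fun h => hO.preimage (hτ h)

/-! ### The main theorem -/

theorem mainTheorem8 {K G M : Type*} {dK dG dM : ℕ}
    [TopologicalSpace K] [Group K] [ChartedSpace (EuclideanSpace ℝ (Fin dK)) K]
    [LieGroup (𝓡 dK) ∞ K] [CompactSpace K] [T2Space K]
    [TopologicalSpace G] [Group G] [ChartedSpace (EuclideanSpace ℝ (Fin dG)) G]
    [LieGroup (𝓡 dG) ∞ G] [CompactSpace G] [T2Space G]
    [TopologicalSpace M] [ChartedSpace (EuclideanSpace ℝ (Fin dM)) M]
    [IsManifold (𝓡 dM) ∞ M] [T2Space M] [SecondCountableTopology M]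
    [MulAction G M] [ContMDiffSMul (𝓡 dG) (𝓡 dM) ∞ G M]
    (x : M) (σ : K →ₜ* MulAction.stabilizer G x) :
    -- a Lie group is a topological group, and a smooth action is continuous
    haveI : IsTopologicalGroup G := topologicalGroup_of_lieGroup (𝓡 dG) ∞
    haveI : ContinuousSMul G M := ContMDiffSMul.continuousSMul ∞ (I := 𝓡 dG) (I' := 𝓡 dM)
    -- (i)
    (IsOpen (homSigmaBar σ) ∧ IsClosed (homSigmaBar σ) ∧
      saturation G (homSigmaBar σ) = homSigmaBar σ ∧
      ∃ e : BalancedProduct (imageCentralizer σ) (satFix σ) ≃ₜ homSigmaBar σ,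
        (∀ (g : G) (y : satFix σ) (k : K),
          (e (BalancedProduct.mk (imageCentralizer σ) (satFix σ) (g, y))).1.map k =
            (g * (σ k : G) * g⁻¹, g • (y : M))) ∧
        (∀ (g : G) (z : BalancedProduct (imageCentralizer σ) (satFix σ)),
          (e (g • z)).1 = g • (e z).1) ∧
        -- `sat_H(fix)` is an embedded submanifold of `M`, and `hom(K, G ⋉ M; σ̄(x))` is a smooth
        -- manifold, with the smooth structure for which `G × sat_H(fix) → G ×_H sat_H(fix)`
        -- followed by `e` is a submersion
        ∃ (dS : ℕ) (_ : ChartedSpace (EuclideanSpace ℝ (Fin dS)) (satFix σ))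
          (dC : ℕ) (_ : ChartedSpace (EuclideanSpace ℝ (Fin dC)) (homSigmaBar σ)),
          IsManifold (𝓡 dS) ∞ (satFix σ) ∧
          Manifold.IsSmoothEmbedding (𝓡 dS) (𝓡 dM) ∞ (Subtype.val : satFix σ → M) ∧
          IsManifold (𝓡 dC) ∞ (homSigmaBar σ) ∧
          T2Space (homSigmaBar σ) ∧ SecondCountableTopology (homSigmaBar σ) ∧
          IsSmoothSubmersion ((𝓡 dG).prod (𝓡 dS)) (𝓡 dC)
            (fun p : G × satFix σ =>
              e (BalancedProduct.mk (imageCentralizer σ) (satFix σ) p))) ∧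
    -- (ii)
    homSigmaBar σ = saturation G {φ | ∃ (y : M)
      (hy : y ∈ MulAction.fixedPoints (imageSubgroup σ) M),
        y ∈ fixComponent (imageSubgroup σ) x ∧ φ = sigmaBar σ y hy} ∧
    TopGroupoid.sigmaSet (sigmaBarBase σ) =
      saturation G (fixComponent (imageSubgroup σ) x) := by
  have hK : IsTopologicalGroup K := topologicalGroup_of_lieGroup (𝓡 dK) ∞
  have hG : IsTopologicalGroup G := topologicalGroup_of_lieGroup (𝓡 dG) ∞
  have hGM : ContinuousSMul G M := ContMDiffSMul.continuousSMul ∞ (I := 𝓡 dG) (I' := 𝓡 dM)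
  have hex : ∀ z : M, (∀ k, (σ k : G) • z = z) →
      Nonempty (EquivariantChart dM (fun (k : K) (z : M) => (σ k : G) • z) z) := fun z hz =>
    nonempty_equivariantChart (𝓡 dG) (N := G) (γ := fun k => (σ k : G)) (a := fun p => p.1 • p.2)
      contMDiff_smul (continuous_subtype_val.comp σ.continuous_toFun) (fun _ _ => rfl)
      (fun z => by simp) (fun k k' z => by simp [mul_smul]) hz
  obtain ⟨C⟩ := hex x fun k => (σ k).2
  have hopen : IsOpen (homSigmaBar σ) ∧ IsClosed (homSigmaBar σ) := by
    rw [homSigmaBar_eq_range σ hex dG]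
    exact (isClopen_range_satOrbitMap σ hex dG).symm
  have hHS : ∀ h ∈ imageCentralizer σ, ∀ y ∈ satFix σ, h • y ∈ satFix σ :=
    fun h hh y hy => smul_mem_satFix σ hh hy
  have hslice := exists_sliceChart_satFix σ hex (dG := dG) C
  obtain ⟨csS, hmS, hval⟩ := exists_isSmoothEmbedding_subtypeVal hslice
  let σ' : K →* G := (MulAction.stabilizer G x).subtype.comp σ.toMonoidHom
  obtain ⟨CG⟩ := nonempty_equivariantChart_conj (d := dG) (σ := σ')
    (continuous_subtype_val.comp σ.continuous_toFun)
  obtain ⟨eG, heG⟩ := exists_continuousLinearEquiv_of_proj CG.proj_proj rfl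
  -- The centralizer is the fixed point set of conjugation through σ, so the linearised chart at 1
  -- is a slice chart for it.
  have hH : ∀ z ∈ CG.chart.source, z ∈ imageCentralizer σ ↔ (eG.symm (CG.chart z)).2 = 0 := by
    intro z hz
    rw [heG, ← CG.forall_act_eq_iff hz, mem_imageCentralizer_iff]
    exact forall_congr' fun k => mul_inv_eq_iff_eq_mul.symm
  obtain ⟨e, he⟩ := exists_homeomorph_homSigmaBar σ hex dG
  have hmk : Continuous (BalancedProduct.mk (imageCentralizer σ) (satFix σ)) :=
    continuous_coinduced_rng
  -- The resulting dimension is (dim G - dim H) + dim S.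
  obtain ⟨csC, hmC, hsub⟩ := exists_isSmoothSubmersion_of_balancedProduct hHS hval hslice CG eG hH
    (q := fun p => e (BalancedProduct.mk (imageCentralizer σ) (satFix σ) p))
    (e.continuous.comp hmk) (e.surjective.comp Quotient.mk_surjective)
    (e.isOpenMap.comp (BalancedProduct.isOpenMap_mk hHS))
    (fun a b => e.injective.eq_iff.trans Quotient.eq)
  -- Being Hausdorff and second countable is inherited from C(K, G × M), where compactness of K and
  -- G supplies the second countability of both groups.
  have hemb : Topology.IsEmbedding fun φ : homSigmaBar σ => φ.1.map :=
    TopGroupoid.Hom.isEmbedding_map.comp Topology.IsEmbedding.subtypeVal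
  have hK2 : SecondCountableTopology K :=
    ChartedSpace.secondCountable_of_sigmaCompact (EuclideanSpace ℝ (Fin dK)) K
  have hG2 : SecondCountableTopology G :=
    ChartedSpace.secondCountable_of_sigmaCompact (EuclideanSpace ℝ (Fin dG)) G
  have hKl : LocallyCompactSpace K := inferInstance
  refine ⟨⟨hopen.1, hopen.2, saturation_homSigmaBar σ hex dG, e, fun g y k => ?_, ?_,
    _, csS, _, csC, hmS, hval, hmC, hemb.t2Space, hemb.secondCountableTopology, hsub⟩, ?_,
    sigmaSet_sigmaBarBase σ hex dG⟩
  · rw [he]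
    rfl
  · rintro g ⟨p⟩
    have h1 := he (g * p.1, p.2)
    have h2 := he p
    exact h1.trans ((mul_smul g p.1 _).trans (congrArg (g • ·) h2.symm))
  · rw [homSigmaBar_eq_range σ hex dG, saturation_eq_range_satOrbitMap]
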